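/- Let $(X_k)_{k\in\mathbb Z}$ be a (strictly) stationary sequence of real random variables on a probability space $(\Omega,\mathcal F,P)$ with $\mathbb E[X_0^2]<\infty$ and $\mathbb E[X_0]=0$. Put $S_n=\sum_{i=0}^{n-1}X_i$ and let $\mathcal F_k$ be the $\sigma$-field generated by the $X_i$ with $i\le k$. For $k\ge 1$ define the strong mixing coefficients $$\alpha_k=\sup\{|P(A\cap B)-P(A)P(B)| : A\in\mathcal F_0,\ B\in\sigma(X_k)\},$$ and let $Q_{|X_0|}(u)=\inf\{t\ge 0: P(|X_0|>t)\le u\}$ (with $\inf\emptyset=+\infty$) be the càdlàg inverse of $t\mapsto P(|X_0|>t)$. Assume that $$\sum_{k\ge 1}\mathbb E\bigl[X_0^2\, I\bigl(|X_0|\ge Q_{|X_0|}(2\alpha_k)\bigr)\bigr]<\infty .$$ Then there exist square-integrable random variables $(D_i)_{i\in\mathbb Z}$ such that $D_i$ is $\mathcal F_{i+1}$-measurable, the sequence of pairs $(X_i,D_i)_{i\in\mathbb Z}$ is stationary, $M_n=\sum_{i=0}^{n-1}D_i$ ($n\ge 0$) is a martingale with respect to $(\mathcal F_n)_{n\ge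 0}$, and $$\frac1n\,\mathbb E\Bigl[\max_{1\le j\le n}(S_j-M_j)^2\Bigr]\longrightarrow 0\qquad (n\to\infty).$$ -/

import Mathlib

open MeasureTheory ProbabilityTheory Filter Topology
open scoped ENNReal

namespace StrongMixing

/-- Strict stationarity of a two-sided process: the law of the whole path is invariant under
every shift of time. -/
def IsStationary {Ω E : Type*} [MeasurableSpace Ω] [MeasurableSpace E]
    (X : ℤ → Ω → E) (μ : Measure Ω) : Prop :=
  ∀ k : ℤ, IdentDistrib (fun ω (i : ℤ) => X (i + k) ω) (fun ω (i : ℤ) => X i ω) μ μ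

/-- The past filtration: `past X hX k` is the `σ`-field generated by the `X i` with `i ≤ k`. -/
noncomputable def past {Ω : Type*} [m : MeasurableSpace Ω] (X : ℤ → Ω → ℝ) (hX : ∀ i, Measurable (X i)) :
    Filtration ℤ m :=
  Filtration.natural X fun i => (hX i).stronglyMeasurable

/-- The past filtration restricted to the nonnegative times. -/
noncomputable def pastNat {Ω : Type*} [m : MeasurableSpace Ω] (X : ℤ → Ω → ℝ) (hX : ∀ i, Measurable (X i)) :
    Filtration ℕ m where
  seq n := past X hX (n : ℤ)
  mono' _ _ h := (past X hX).mono (Int.ofNat_le.mpr h)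
  le' n := (past X hX).le (n : ℤ)

/-- The strong mixing coefficient of two `σ`-fields,
`sup {|P (A ∩ B) - P A * P B| : A ∈ 𝒜, B ∈ ℬ}`. -/
noncomputable def alphaCoeff {Ω : Type*} [MeasurableSpace Ω] (μ : Measure Ω)
    (𝒜 ℬ : MeasurableSpace Ω) : ℝ≥0∞ :=
  ⨆ (A : Set Ω) (_ : MeasurableSet[𝒜] A) (B : Set Ω) (_ : MeasurableSet[ℬ] B),
    ENNReal.ofReal |μ.real (A ∩ B) - μ.real A * μ.real B|

/-- `α(n)`: the strong mixing coefficient between the past `σ (X i : i ≤ 0)` and the single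
future variable `X n`. -/
noncomputable def alpha {Ω : Type*} [MeasurableSpace Ω] (μ : Measure Ω)
    (X : ℤ → Ω → ℝ) (hX : ∀ i, Measurable (X i)) (n : ℕ) : ℝ≥0∞ :=
  alphaCoeff μ (past X hX 0) (MeasurableSpace.comap (X n) inferInstance)

/-- The upper quantile function `Q_{|Y|}`, the càdlàg inverse of `t ↦ P (|Y| > t)`:
`Q_{|Y|} u = inf {t ≥ 0 : P (|Y| > t) ≤ u}`. It is extended-valued, so that `Q_{|Y|} 0` is the
essential supremum of `|Y|`, possibly `∞`. -/
noncomputable def absQuantile {Ω : Type*} [MeasurableSpace Ω] (μ : Measure Ω)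
    (Y : Ω → ℝ) (u : ℝ≥0∞) : ℝ≥0∞ :=
  sInf {t : ℝ≥0∞ | μ {ω | t < ‖Y ω‖ₑ} ≤ u}

/-- `∑_{k ≥ 1} E [X₀² 1(|X₀| ≥ Q_{|X₀|}(2 α(k)))] < ∞`. -/
def DoukhanMassartRioCondition {Ω : Type*} [MeasurableSpace Ω] (μ : Measure Ω)
    (X : ℤ → Ω → ℝ) (hX : ∀ i, Measurable (X i)) : Prop :=
  ∑' k : ℕ, ∫⁻ ω in {ω | absQuantile μ (X 0) (2 * alpha μ X hX (k + 1)) ≤ ‖X 0 ω‖ₑ},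
    ‖X 0 ω‖ₑ ^ 2 ∂μ < ∞

/-- The sum of the terms with indices `0, …, n - 1`. -/
def partialSum {Ω : Type*} (X : ℤ → Ω → ℝ) (n : ℕ) (ω : Ω) : ℝ :=
  ∑ i ∈ Finset.range n, X (i : ℤ) ω

/-- There is a square-integrable martingale `M_n = D_0 + ⋯ + D_{n-1}`, adapted to the past
filtration of `X` and with stationary differences (jointly with `X`, so that the `D_i` are the
shifts of one variable), such that `E [max_{1 ≤ j ≤ n} (S_j - M_j)²] / n → 0`. -/
def HasMaximalMartingaleApproximation {Ω : Type*} [MeasurableSpace Ω] (μ : Measure Ω)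
    (X : ℤ → Ω → ℝ) (hX : ∀ i, Measurable (X i)) : Prop :=
  ∃ D : ℤ → Ω → ℝ,
    (∀ i, StronglyMeasurable[past X hX (i + 1)] (D i)) ∧
    (∀ i, MemLp (D i) 2 μ) ∧
    IsStationary (fun i ω => (X i ω, D i ω)) μ ∧
    Martingale (partialSum D) (pastNat X hX) μ ∧
    Tendsto
      (fun n : ℕ =>
        (∫⁻ ω, ⨆ j ∈ Finset.Icc 1 n, ‖partialSum X j ω - partialSum D j ω‖ₑ ^ 2 ∂μ) / (n : ℝ≥0∞))
      atTop (𝓝 0)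

end StrongMixing

/-! The work takes place on path space, with `T` the shift, `G` the past and `f x = x 0`. For a
horizon `p`, let `A_p` be the average of `E[f ∘ T^i | G]` over `1 ≤ i ≤ p`, and let `C_p` be the
averaged sum of predictions called `corrector`. Then `f = δ_p + A_p + (C_p - C_p ∘ T)`, where `δ_p`
is a martingale difference. For fixed `p` the coboundary adds only `o(n)` to the second moment of
the maximum, so everything rests on `A_p`.

The maximal inequality `lintegral_iSup_sq_sum_le` gives `E max S_j² ≤ n (8c + 24b)`. Here `c` bounds
`E Y_j²`, and `b` bounds the correlation of `S_n - S_{j+1}` with every `F_j`-measurable `W` such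
that `|W| ≤ |Y_j|`. For `Y_j = A_p ∘ T^j` both constants reduce to averages of correlations `E[W f ∘
T^k]`, hence to a Cesàro mean of tails of a summable sequence `a`; this tends to 0 as `p → ∞`.

The sequence `a` must depend neither on `p` nor on `W`. Truncating both variables at the level
`Q(2α_k)` gives a covariance bound (`abs_integral_mul_le_tail`) that sees `W` only through `E (W² -
t²)₊`. Conditional Jensen bounds this quantity by that of `f` when `W = A_p`, hence also when `|W| ≤
|A_p|`.

By orthogonality `n E (δ_p - δ_q)²` is at most the second moment of the corresponding maximum, so
`δ_p` is Cauchy in `L²`. Its limit `D`, evaluated along the shifted paths, is the required sequence.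
-/

namespace StrongMixing

/-! ### A maximal inequality for adapted sequences -/

section MaximalInequality

/-- The running maximum `max (0, s 1, …, s n)` of a real sequence. -/
def runMax (s : ℕ → ℝ) : ℕ → ℝ
  | 0 => 0
  | n + 1 => max (runMax s n) (s (n + 1))

lemma runMax_nonneg (s : ℕ → ℝ) (n : ℕ) : 0 ≤ runMax s n := by
  induction n with
  | zero => exact le_rfl
  | succ n ih => exact ih.trans (le_max_left _ _)

lemma runMax_mono (s : ℕ → ℝ) : Monotone (runMax s) :=
  monotone_nat_of_le_succ fun _ => le_max_left _ _

lemma le_runMax {s : ℕ → ℝ} (h0 : s 0 = 0) (n : ℕ) : s n ≤ runMax s n := by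
  cases n with
  | zero => exact h0.le
  | succ n => exact le_max_right _ _

lemma abs_runMax_succ_sub_le {s : ℕ → ℝ} (h0 : s 0 = 0) (n : ℕ) :
    |runMax s (n + 1) - runMax s n| ≤ |s (n + 1) - s n| := by
  have h1 := le_runMax h0 n
  have h2 := le_abs_self (s (n + 1) - s n)
  have h3 := abs_nonneg (s (n + 1) - s n)
  rw [abs_of_nonneg (sub_nonneg.2 (runMax_mono s n.le_succ))]
  rcases max_cases (runMax s n) (s (n + 1)) with ⟨h, -⟩ | ⟨h, -⟩ <;>
    · simp only [runMax, h]; linarith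

/-- Sum `b² - a² ≤ 2 (b - a) b` over successive values of the maximum: it moves at step `j + 1` only
when its new value is `s (j + 1)`. -/
lemma runMax_sq_le_two_mul_sum (s : ℕ → ℝ) (n : ℕ) :
    runMax s n ^ 2 ≤ 2 * ∑ j ∈ Finset.range n, (runMax s (j + 1) - runMax s j) * s (j + 1) := by
  induction n with
  | zero => simp [runMax]
  | succ n ih =>
    rw [Finset.sum_range_succ, mul_add]
    rcases max_cases (runMax s n) (s (n + 1)) with ⟨h, h'⟩ | ⟨h, h'⟩ <;>
      · simp only [runMax, h] at ih ⊢
        nlinarith [sq_nonneg (runMax s n - s (n + 1))]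

/-- Writing `s (j + 1) = s n - (s n - s (j + 1))` pairs each increment of the maximum with the
future. The remaining term `2 M s n` is at most `M² / 2 + 2 (s n)²`, and half of `M²` is absorbed on
the left. -/
lemma runMax_sq_le (s : ℕ → ℝ) (n : ℕ) :
    runMax s n ^ 2 ≤ 4 * s n ^ 2 +
      4 * ∑ j ∈ Finset.range n, (runMax s j - runMax s (j + 1)) * (s n - s (j + 1)) := by
  have h1 := runMax_sq_le_two_mul_sum s n
  have h2 : ∑ j ∈ Finset.range n, (runMax s (j + 1) - runMax s j) = runMax s n := by
    rw [Finset.sum_range_sub]; simp [runMax]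
  have h3 : ∑ j ∈ Finset.range n, (runMax s j - runMax s (j + 1)) * (s n - s (j + 1)) =
      ∑ j ∈ Finset.range n, (runMax s (j + 1) - runMax s j) * s (j + 1) - runMax s n * s n := by
    rw [← h2, Finset.sum_mul, ← Finset.sum_sub_distrib]
    exact Finset.sum_congr rfl fun _ _ => by ring
  rw [h3]
  nlinarith [sq_nonneg (runMax s n - 2 * s n)]

lemma sq_sum_range_eq (y : ℕ → ℝ) (n : ℕ) :
    (∑ i ∈ Finset.range n, y i) ^ 2 = ∑ j ∈ Finset.range n, y j ^ 2 +
      2 * ∑ j ∈ Finset.range n, y j *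
        (∑ i ∈ Finset.range n, y i - ∑ i ∈ Finset.range (j + 1), y i) := by
  induction n with
  | zero => simp
  | succ n ih =>
    simp only [Finset.sum_range_succ _ n] at ih ⊢
    have h : ∀ j, y j * (∑ i ∈ Finset.range n, y i + y n - ∑ i ∈ Finset.range (j + 1), y i) =
      y j * (∑ i ∈ Finset.range n, y i - ∑ i ∈ Finset.range (j + 1), y i) + y j * y n :=
      fun j => by ring
    simp only [h, Finset.sum_add_distrib, ← Finset.sum_mul]
    linear_combination ih

lemma enorm_sq_eq_ofReal (x : ℝ) : ‖x‖ₑ ^ 2 = ENNReal.ofReal (x ^ 2) := by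
  rw [Real.enorm_eq_ofReal_abs, ← ENNReal.ofReal_pow (abs_nonneg x), sq_abs]

lemma sq_le_runMax_sq_add {s : ℕ → ℝ} {j n : ℕ} (h0 : s 0 = 0) (h : j ≤ n) :
    s j ^ 2 ≤ runMax s n ^ 2 + runMax (fun i => -s i) n ^ 2 := by
  have h1 := (le_runMax h0 j).trans (runMax_mono s h)
  have h2 := (le_runMax (s := fun i => -s i) (by simp [h0]) j).trans
    (runMax_mono (fun i => -s i) h)
  have h3 := runMax_nonneg s n
  have h4 := runMax_nonneg (fun i => -s i) n
  rcases le_total 0 (s j) with h5 | h5 <;> nlinarith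

variable {Ω : Type*} {G m : MeasurableSpace Ω} {μ : Measure Ω}

lemma measurable_runMax {S : ℕ → Ω → ℝ} (n : ℕ)
    (hS : ∀ k ≤ n, Measurable[G] (S k)) : Measurable[G] (fun ω => runMax (fun k => S k ω) n) := by
  induction n with
  | zero => exact measurable_const
  | succ n ih => exact (ih fun k hk => hS k (hk.trans n.le_succ)).max (hS _ le_rfl)

lemma memLp_runMax {S : ℕ → Ω → ℝ} (hS : ∀ k, MemLp (S k) 2 μ) (n : ℕ) :
    MemLp (fun ω => runMax (fun k => S k ω) n) 2 μ := by
  induction n with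
  | zero => exact MemLp.zero
  | succ n ih => exact ih.sup (hS _)

/-- Both `Y j` and the increment `M j - M (j + 1)` are `F j`-measurable and at most `|Y j|` in size.
So `hb` applies to each: the expansion of `4 S_n²` gives `4c + 8b`, the increments of the maximum
give `4b`. -/
lemma integral_runMax_sq_le {F : ℕ → MeasurableSpace Ω} (hF : Monotone F) {Y : ℕ → Ω → ℝ}
    (hY : ∀ k, Measurable[F k] (Y k)) (hY2 : ∀ k, MemLp (Y k) 2 μ)
    {n : ℕ} {b c : ℝ} (hc : ∀ k, ∫ ω, Y k ω ^ 2 ∂μ ≤ c)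
    (hb : ∀ j < n, ∀ W : Ω → ℝ, Measurable[F j] W → MemLp W 2 μ → (∀ ω, |W ω| ≤ |Y j ω|) →
      ∫ ω, W ω * (∑ i ∈ Finset.range n, Y i ω - ∑ i ∈ Finset.range (j + 1), Y i ω) ∂μ ≤ b) :
    ∫ ω, runMax (fun k => ∑ i ∈ Finset.range k, Y i ω) n ^ 2 ∂μ ≤ n * (4 * c + 12 * b) := by
  set S : ℕ → Ω → ℝ := fun k ω => ∑ i ∈ Finset.range k, Y i ω with hS
  have hS2 : ∀ k, MemLp (S k) 2 μ := fun k => memLp_finsetSum _ fun i _ => hY2 i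
  have hSm : ∀ k j, k ≤ j + 1 → Measurable[F j] (S k) := fun k j hk =>
    Finset.measurable_fun_sum _ fun i hi => (hY i).mono
      (hF (Nat.lt_succ_iff.1 ((Finset.mem_range.1 hi).trans_le hk))) le_rfl
  have hM2 := memLp_runMax hS2
  set M : ℕ → Ω → ℝ := fun k ω => runMax (fun k => S k ω) k with hM
  have hMm : ∀ k j, k ≤ j + 1 → Measurable[F j] (M k) := fun k j hk =>
    measurable_runMax k fun i hi => hSm i j (hi.trans hk)
  have hpt : ∀ ω, M n ω ^ 2 ≤ 4 * ∑ j ∈ Finset.range n, Y j ω ^ 2 +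
      8 * ∑ j ∈ Finset.range n, Y j ω * (S n ω - S (j + 1) ω) +
      4 * ∑ j ∈ Finset.range n, (M j ω - M (j + 1) ω) * (S n ω - S (j + 1) ω) := by
    intro ω
    have h1 := runMax_sq_le (fun k => S k ω) n
    have h2 := sq_sum_range_eq (fun i => Y i ω) n
    simp only [hM]
    simp only [hS] at h1 h2 ⊢
    linarith
  have hd : ∀ j, MemLp (fun ω => S n ω - S (j + 1) ω) 2 μ := fun j => (hS2 n).sub (hS2 (j + 1))
  have hi1 : ∀ j, Integrable (fun ω => Y j ω ^ 2) μ := fun j => (hY2 j).integrable_sq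
  have hi2 : ∀ j, Integrable (fun ω => Y j ω * (S n ω - S (j + 1) ω)) μ := fun j =>
    (hY2 j).integrable_mul (hd j)
  have hi3 : ∀ j, Integrable (fun ω => (M j ω - M (j + 1) ω) * (S n ω - S (j + 1) ω)) μ :=
    fun j => ((hM2 j).sub (hM2 (j + 1))).integrable_mul (hd j)
  have hI1 := (integrable_finsetSum (Finset.range n) fun j _ => hi1 j).const_mul 4
  have hI2 := (integrable_finsetSum (Finset.range n) fun j _ => hi2 j).const_mul 8
  have hI3 := (integrable_finsetSum (Finset.range n) fun j _ => hi3 j).const_mul 4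
  have hint := integral_mono (hM2 n).integrable_sq ((hI1.add hI2).add hI3) hpt
  have e : ∫ ω, (4 * ∑ j ∈ Finset.range n, Y j ω ^ 2 +
      8 * ∑ j ∈ Finset.range n, Y j ω * (S n ω - S (j + 1) ω) +
      4 * ∑ j ∈ Finset.range n, (M j ω - M (j + 1) ω) * (S n ω - S (j + 1) ω)) ∂μ =
      4 * ∑ j ∈ Finset.range n, ∫ ω, Y j ω ^ 2 ∂μ +
      8 * ∑ j ∈ Finset.range n, ∫ ω, Y j ω * (S n ω - S (j + 1) ω) ∂μ +
      4 * ∑ j ∈ Finset.range n, ∫ ω, (M j ω - M (j + 1) ω) * (S n ω - S (j + 1) ω) ∂μ := by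
    have e1 := integral_add (hI1.add hI2) hI3
    have e2 := integral_add hI1 hI2
    simp only [Pi.add_apply] at e1 e2
    rw [e1, e2, integral_const_mul,
      integral_const_mul, integral_const_mul, integral_finsetSum _ fun j _ => hi1 j,
      integral_finsetSum _ fun j _ => hi2 j, integral_finsetSum _ fun j _ => hi3 j]
  have b1 : ∑ j ∈ Finset.range n, ∫ ω, Y j ω ^ 2 ∂μ ≤ n * c := by
    simpa using Finset.sum_le_card_nsmul (Finset.range n) _ c fun j _ => hc j
  have b2 : ∑ j ∈ Finset.range n, ∫ ω, Y j ω * (S n ω - S (j + 1) ω) ∂μ ≤ n * b := by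
    simpa using Finset.sum_le_card_nsmul (Finset.range n) _ b fun j hj =>
      hb j (Finset.mem_range.1 hj) (Y j) (hY j) (hY2 j) fun ω => le_rfl
  have b3 : ∑ j ∈ Finset.range n, ∫ ω, (M j ω - M (j + 1) ω) * (S n ω - S (j + 1) ω) ∂μ
      ≤ n * b := by
    have := Finset.sum_le_card_nsmul (Finset.range n) _ b fun j hj =>
      hb j (Finset.mem_range.1 hj) (fun ω => M j ω - M (j + 1) ω)
        ((hMm j j j.le_succ).sub (hMm (j + 1) j le_rfl)) ((hM2 j).sub (hM2 (j + 1))) fun ω => by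
          rw [abs_sub_comm]
          refine (abs_runMax_succ_sub_le (s := fun k => S k ω) (by simp [hS]) j).trans_eq ?_
          simp [hS, Finset.sum_range_succ]
    simpa using this
  refine hint.trans ?_
  change ∫ ω, (4 * ∑ j ∈ Finset.range n, Y j ω ^ 2 +
      8 * ∑ j ∈ Finset.range n, Y j ω * (S n ω - S (j + 1) ω) +
      4 * ∑ j ∈ Finset.range n, (M j ω - M (j + 1) ω) * (S n ω - S (j + 1) ω)) ∂μ ≤ _
  rw [e]
  linarith

/-- The class of admissible `W` is symmetric, so the one-sided bound holds for `-Y` too; adding the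
two doubles the constants. -/
lemma lintegral_iSup_sq_sum_le {F : ℕ → MeasurableSpace Ω} (hF : Monotone F) {Y : ℕ → Ω → ℝ}
    (hY : ∀ k, Measurable[F k] (Y k)) (hY2 : ∀ k, MemLp (Y k) 2 μ)
    {n : ℕ} {b c : ℝ} (hc : ∀ k, ∫ ω, Y k ω ^ 2 ∂μ ≤ c)
    (hb : ∀ j < n, ∀ W : Ω → ℝ, Measurable[F j] W → MemLp W 2 μ → (∀ ω, |W ω| ≤ |Y j ω|) →
      ∫ ω, W ω * (∑ i ∈ Finset.range n, Y i ω - ∑ i ∈ Finset.range (j + 1), Y i ω) ∂μ ≤ b) :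
    ∫⁻ ω, ⨆ j ∈ Finset.Icc 1 n, ‖∑ i ∈ Finset.range j, Y i ω‖ₑ ^ 2 ∂μ ≤
      ENNReal.ofReal (n * (8 * c + 24 * b)) := by
  have h1 := integral_runMax_sq_le hF hY hY2 hc hb
  have h2 := integral_runMax_sq_le hF (fun k => (hY k).neg) (fun k => (hY2 k).neg)
    (n := n) (b := b) (c := c) (by simpa using hc) fun j hj W hW hW2 hWY => by
      convert hb j hj (fun ω => -W ω) hW.neg hW2.neg (by simpa using hWY) using 3 with ω
      simp only [Pi.neg_apply, Finset.sum_neg_distrib]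
      ring
  simp only [Pi.neg_apply, Finset.sum_neg_distrib] at h2
  set S : ℕ → Ω → ℝ := fun k ω => ∑ i ∈ Finset.range k, Y i ω with hS
  have hS2 : ∀ k, MemLp (S k) 2 μ := fun k => memLp_finsetSum _ fun i _ => hY2 i
  have hi1 := (memLp_runMax hS2 n).integrable_sq
  have hi2 := (memLp_runMax (fun k => (hS2 k).neg) n).integrable_sq
  calc _ ≤ ∫⁻ ω, ENNReal.ofReal (runMax (fun k => S k ω) n ^ 2 +
        runMax (fun k => -S k ω) n ^ 2) ∂μ := by
        refine lintegral_mono fun ω => iSup₂_le fun j hj => ?_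
        rw [enorm_sq_eq_ofReal]
        exact ENNReal.ofReal_le_ofReal (sq_le_runMax_sq_add (s := fun k => S k ω)
          (by simp [hS]) (Finset.mem_Icc.1 hj).2)
    _ = ENNReal.ofReal (∫ ω, (runMax (fun k => S k ω) n ^ 2 +
        runMax (fun k => -S k ω) n ^ 2) ∂μ) :=
        (ofReal_integral_eq_lintegral_ofReal (hi1.add hi2)
          (ae_of_all _ fun ω => add_nonneg (sq_nonneg _) (sq_nonneg _))).symm
    _ ≤ _ := by
        refine ENNReal.ofReal_le_ofReal ?_
        have := integral_add hi1 hi2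
        simp only [Pi.neg_apply] at this
        rw [this]
        linarith

lemma integral_comp_of_measurePreserving {Ω' : Type*} {m' : MeasurableSpace Ω'} {ν : Measure Ω'}
    {T : Ω → Ω'} (hT : MeasurePreserving T μ ν) {h : Ω' → ℝ} (hh : AEStronglyMeasurable h ν) :
    ∫ ω, h (T ω) ∂μ = ∫ ω, h ω ∂ν := by
  rw [← hT.map_eq, integral_map hT.measurable.aemeasurable (hT.map_eq.symm ▸ hh)]

lemma setIntegral_comp_of_measurePreserving {Ω' : Type*} {m' : MeasurableSpace Ω'}
    {ν : Measure Ω'} {T : Ω → Ω'} (hT : MeasurePreserving T μ ν) {B : Set Ω'}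
    (hB : MeasurableSet B) {h : Ω' → ℝ} (hh : AEStronglyMeasurable h ν) :
    ∫ ω in T ⁻¹' B, h (T ω) ∂μ = ∫ ω in B, h ω ∂ν := by
  conv_rhs => rw [← hT.map_eq]
  rw [setIntegral_map hB (hT.map_eq.symm ▸ hh) hT.measurable.aemeasurable]

lemma comap_iterate_mono {T : Ω → Ω} (hG : G ≤ G.comap T) :
    Monotone fun k => G.comap (T^[k]) := by
  refine monotone_nat_of_le_succ fun k => ?_
  rw [Function.iterate_succ', ← MeasurableSpace.comap_comp]
  exact MeasurableSpace.comap_mono hG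

lemma exists_measurable_comp {α β : Type*} {G : MeasurableSpace β} {T : α → β}
    {W : α → ℝ} (hW : Measurable[G.comap T] W) :
    ∃ V : β → ℝ, Measurable[G] V ∧ W = fun x => V (T x) := by
  obtain ⟨V, hV, rfl⟩ := hW.exists_eq_measurable_comp
  exact ⟨V, hV, rfl⟩

lemma integral_mul_sum {W : Ω → ℝ} {h : ℕ → Ω → ℝ} (hW : MemLp W 2 μ)
    (hh : ∀ l, MemLp (h l) 2 μ) (N : ℕ) :
    ∫ ω, W ω * ∑ l ∈ Finset.range N, h l ω ∂μ =
      ∑ l ∈ Finset.range N, ∫ ω, W ω * h l ω ∂μ := by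
  simp only [Finset.mul_sum]
  exact integral_finsetSum _ fun l _ => hW.integrable_mul (hh l)

lemma exists_measurable_comp_of_abs_le {α β : Type*} {G : MeasurableSpace β} {T : α → β}
    {W : α → ℝ} (hW : Measurable[G.comap T] W) {y : β → ℝ} (hy : Measurable[G] y)
    (hWy : ∀ x, |W x| ≤ |y (T x)|) :
    ∃ V : β → ℝ, Measurable[G] V ∧ (∀ z, |V z| ≤ |y z|) ∧ W = fun x => V (T x) := by
  obtain ⟨V, hV, rfl⟩ := exists_measurable_comp hW
  -- The factor `V` is controlled only on the range of `T`; clamping it between `±|y|` makes the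
  -- bound hold everywhere and leaves `V ∘ T` unchanged.
  refine ⟨fun z => max (-|y z|) (min (V z) |y z|), ?_, fun z => ?_, ?_⟩
  · have hy' : Measurable[G] fun z => |y z| := hy.norm
    exact hy'.neg.max (hV.min hy')
  · refine abs_le.2 ⟨le_max_left _ _, max_le ?_ (min_le_right _ _)⟩
    linarith [abs_nonneg (y z)]
  · funext x
    have := abs_le.1 (hWy x)
    simp only at this ⊢
    rw [min_eq_left this.2, max_eq_right this.1]

lemma memLp_of_abs_le {W y : Ω → ℝ} (hy : MemLp y 2 μ) (hW : Measurable W)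
    (h : ∀ ω, |W ω| ≤ |y ω|) : MemLp W 2 μ :=
  hy.mono hW.aestronglyMeasurable (ae_of_all _ fun ω => by simpa using h ω)

/-- With the filtration `F k = T^{-k} G`, an admissible `W` at time `j` is `V ∘ T^j` with `V`
admissible at time 0, so invariance reduces the correlation hypothesis to time 0. -/
theorem lintegral_iSup_sq_sum_iterate_le {T : Ω → Ω} (hT : MeasurePreserving T μ μ)
    (hGm : G ≤ m) (hG : G ≤ G.comap T) {y : Ω → ℝ}
    (hy : Measurable[G] y) (hy2 : MemLp y 2 μ) {b c : ℝ} (hc : ∫ ω, y ω ^ 2 ∂μ ≤ c)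
    (hb : ∀ N : ℕ, ∀ W : Ω → ℝ, Measurable[G] W → MemLp W 2 μ → (∀ ω, |W ω| ≤ |y ω|) →
      ∫ ω, W ω * ∑ l ∈ Finset.range N, y (T^[l + 1] ω) ∂μ ≤ b) (n : ℕ) :
    ∫⁻ ω, ⨆ j ∈ Finset.Icc 1 n, ‖∑ i ∈ Finset.range j, y (T^[i] ω)‖ₑ ^ 2 ∂μ ≤
      ENNReal.ofReal (n * (8 * c + 24 * b)) := by
  have hTk := hT.iterate
  have hyk : ∀ k, MemLp (fun ω => y (T^[k] ω)) 2 μ := fun k => hy2.comp_measurePreserving (hTk k)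
  refine lintegral_iSup_sq_sum_le (Y := fun k ω => y (T^[k] ω)) (comap_iterate_mono hG)
    (fun k => @Measurable.comp _ _ _ (G.comap T^[k]) G _ _ _ hy (comap_measurable _)) hyk (fun k => ?_) fun j hj W hW hW2 hWy => ?_
  · exact (integral_comp_of_measurePreserving (hTk k)
      (hy2.integrable_sq.aestronglyMeasurable)).trans_le hc
  · obtain ⟨V, hV, hVy, rfl⟩ := exists_measurable_comp_of_abs_le hW hy hWy
    have hV2 : MemLp V 2 μ := memLp_of_abs_le hy2 (hV.mono hGm le_rfl) hVy
    have hsum : MemLp (fun ω => ∑ l ∈ Finset.range (n - (j + 1)), y (T^[l + 1] ω)) 2 μ :=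
      memLp_finsetSum _ fun l _ => hyk (l + 1)
    refine le_trans (le_of_eq ?_) (hb (n - (j + 1)) V hV hV2 hVy)
    refine Eq.trans ?_ (integral_comp_of_measurePreserving (hTk j)
      (hV2.integrable_mul hsum).aestronglyMeasurable)
    refine integral_congr_ae (ae_of_all _ fun ω => ?_)
    simp only [← Function.iterate_add_apply]
    congr 1
    obtain ⟨p, rfl⟩ : ∃ p, n = j + 1 + p := ⟨n - (j + 1), by omega⟩
    rw [Finset.sum_range_add_sub_sum_range (fun i => y (T^[i] ω))]
    simp only [Nat.add_sub_cancel_left]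
    exact Finset.sum_congr rfl fun i _ => by rw [show j + 1 + i = i + 1 + j by omega]

end MaximalInequality

/-! ### The convex function measuring tails -/

section Excess

/-- The excess `(x² - t²)₊` of the square of `x` over the square of `t`. -/
def excess (t x : ℝ) : ℝ := max (x ^ 2 - t ^ 2) 0

lemma excess_nonneg (t x : ℝ) : 0 ≤ excess t x := le_max_right _ _

lemma sq_sub_sq_le_excess (t x : ℝ) : x ^ 2 - t ^ 2 ≤ excess t x := le_max_left _ _

lemma excess_le_sq (t x : ℝ) : excess t x ≤ x ^ 2 :=
  max_le (by nlinarith [sq_nonneg t]) (sq_nonneg x)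

lemma excess_le_excess {t x y : ℝ} (h : |x| ≤ |y|) : excess t x ≤ excess t y :=
  max_le_max (sub_le_sub_right (sq_le_sq.2 h) _) le_rfl

lemma continuous_excess (t : ℝ) : Continuous (excess t) := by
  unfold excess; fun_prop

/-- Jensen's inequality for the convex function `excess t`, obtained from Cauchy–Schwarz. -/
lemma excess_average_le (t : ℝ) {p : ℕ} (hp : p ≠ 0) (x : ℕ → ℝ) :
    excess t ((p : ℝ)⁻¹ * ∑ i ∈ Finset.range p, x i) ≤
      (p : ℝ)⁻¹ * ∑ i ∈ Finset.range p, excess t (x i) := by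
  have hp0 : (0 : ℝ) < p := by positivity
  have h1 : ∑ i ∈ Finset.range p, (x i ^ 2 - t ^ 2) ≤ ∑ i ∈ Finset.range p, excess t (x i) :=
    Finset.sum_le_sum fun i _ => sq_sub_sq_le_excess t (x i)
  have h2 : (∑ i ∈ Finset.range p, x i) ^ 2 ≤ p * ∑ i ∈ Finset.range p, x i ^ 2 := by
    simpa using sq_sum_le_card_mul_sum_sq (s := Finset.range p) (f := x)
  simp only [Finset.sum_sub_distrib, Finset.sum_const, Finset.card_range, nsmul_eq_mul] at h1
  refine max_le ?_ (mul_nonneg (by positivity) (Finset.sum_nonneg fun i _ => excess_nonneg _ _))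
  rw [mul_pow, inv_pow, sub_le_iff_le_add, inv_mul_le_iff₀ (by positivity)]
  refine h2.trans ?_
  have : (p : ℝ) ^ 2 * ((p : ℝ)⁻¹ * ∑ i ∈ Finset.range p, excess t (x i) + t ^ 2) =
      p * (∑ i ∈ Finset.range p, excess t (x i) + p * t ^ 2) := by
    field_simp
  rw [this]
  gcongr
  linarith

variable {Ω : Type*} {m : MeasurableSpace Ω} {μ : Measure Ω}

lemma integrable_excess {W : Ω → ℝ} (hW : MemLp W 2 μ) (t : ℝ) :
    Integrable (fun ω => excess t (W ω)) μ :=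
  hW.integrable_sq.mono' ((continuous_excess t).comp_aestronglyMeasurable hW.1)
    (ae_of_all _ fun ω => by
      rw [Real.norm_of_nonneg (excess_nonneg _ _)]; exact excess_le_sq _ _)

lemma tendsto_integral_excess {W : Ω → ℝ} (hW : MemLp W 2 μ) :
    Tendsto (fun K : ℕ => ∫ ω, excess K (W ω) ∂μ) atTop (𝓝 0) := by
  rw [← integral_zero Ω ℝ (μ := μ)]
  refine tendsto_integral_of_dominated_convergence (fun ω => W ω ^ 2)
    (fun K => (integrable_excess hW K).aestronglyMeasurable) hW.integrable_sq
    (fun K => ae_of_all _ fun ω => ?_) (ae_of_all _ fun ω => ?_)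
  · rw [Real.norm_of_nonneg (excess_nonneg _ _)]; exact excess_le_sq _ _
  · refine tendsto_const_nhds.congr' ?_
    filter_upwards [eventually_ge_atTop ⌈|W ω|⌉₊] with K hK
    have h := Nat.ceil_le.1 hK
    refine (max_eq_right (sub_nonpos.2 (sq_le_sq.2 ?_))).symm
    rwa [Nat.abs_cast]

end Excess

/-! ### Second moments of maxima; coboundaries -/

section MaximalSquare

variable {Ω : Type*} {G m : MeasurableSpace Ω} {μ : Measure Ω} {T : Ω → Ω}

/-- The second moment of `max_{1 ≤ j ≤ n} |∑_{i < j} h ∘ T^i|`. -/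
noncomputable def maxSq {m : MeasurableSpace Ω} (μ : Measure Ω) (T : Ω → Ω) (h : Ω → ℝ) (n : ℕ) :
    ℝ≥0∞ :=
  ∫⁻ ω, ⨆ j ∈ Finset.Icc 1 n, ‖∑ i ∈ Finset.range j, h (T^[i] ω)‖ₑ ^ 2 ∂μ

lemma enorm_add_sq_le (x y : ℝ) : ‖x + y‖ₑ ^ 2 ≤ 2 * ‖x‖ₑ ^ 2 + 2 * ‖y‖ₑ ^ 2 := by
  simp only [enorm_sq_eq_ofReal]
  rw [← ENNReal.ofReal_ofNat 2, ← ENNReal.ofReal_mul (by norm_num),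
    ← ENNReal.ofReal_mul (by norm_num), ← ENNReal.ofReal_add (by positivity) (by positivity)]
  exact ENNReal.ofReal_le_ofReal (by nlinarith [sq_nonneg (x - y)])

lemma lintegral_iSup_enorm_add_sq_le {u v : ℕ → Ω → ℝ} (hu : ∀ j, Measurable (u j)) (n : ℕ) :
    ∫⁻ ω, ⨆ j ∈ Finset.Icc 1 n, ‖u j ω + v j ω‖ₑ ^ 2 ∂μ ≤
      2 * ∫⁻ ω, ⨆ j ∈ Finset.Icc 1 n, ‖u j ω‖ₑ ^ 2 ∂μ +
        2 * ∫⁻ ω, ⨆ j ∈ Finset.Icc 1 n, ‖v j ω‖ₑ ^ 2 ∂μ := by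
  have hm : Measurable fun ω => ⨆ j ∈ Finset.Icc 1 n, ‖u j ω‖ₑ ^ 2 :=
    Measurable.iSup fun j => Measurable.iSup_Prop _ ((hu j).enorm.pow_const 2)
  rw [← lintegral_const_mul' _ _ (by simp), ← lintegral_const_mul' _ _ (by simp),
    ← lintegral_add_left (hm.const_mul 2)]
  refine lintegral_mono fun ω => iSup₂_le fun j hj => (enorm_add_sq_le _ _).trans ?_
  gcongr
  · exact le_iSup₂ (f := fun j (_ : j ∈ Finset.Icc 1 n) => ‖u j ω‖ₑ ^ 2) j hj
  · exact le_iSup₂ (f := fun j (_ : j ∈ Finset.Icc 1 n) => ‖v j ω‖ₑ ^ 2) j hj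

lemma maxSq_add_le (hT : Measurable T) {u v : Ω → ℝ} (hu : Measurable u) (n : ℕ) :
    maxSq μ T (fun ω => u ω + v ω) n ≤ 2 * maxSq μ T u n + 2 * maxSq μ T v n := by
  simp only [maxSq, Finset.sum_add_distrib]
  exact lintegral_iSup_enorm_add_sq_le
    (fun j => Finset.measurable_fun_sum _ fun i _ => hu.comp (hT.iterate i)) n

lemma maxSq_neg (h : Ω → ℝ) (n : ℕ) : maxSq μ T (fun ω => -h ω) n = maxSq μ T h n := by
  simp [maxSq]

lemma lintegral_enorm_sq {h : Ω → ℝ} (hh : MemLp h 2 μ) :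
    ∫⁻ ω, ‖h ω‖ₑ ^ 2 ∂μ = ENNReal.ofReal (∫ ω, h ω ^ 2 ∂μ) := by
  simp only [enorm_sq_eq_ofReal]
  exact (ofReal_integral_eq_lintegral_ofReal hh.integrable_sq
    (ae_of_all _ fun ω => sq_nonneg _)).symm

/-- Every `θ_j²` is at most `K²` plus its excess over `K²`, and the largest excess is at most the
sum of all of them. -/
lemma lintegral_iSup_enorm_iterate_sq_le [IsProbabilityMeasure μ] (hT : MeasurePreserving T μ μ)
    {θ : Ω → ℝ} (hθ : MemLp θ 2 μ) (K : ℝ) (n : ℕ) :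
    ∫⁻ ω, ⨆ j ∈ Finset.Icc 1 n, ‖θ (T^[j] ω)‖ₑ ^ 2 ∂μ ≤
      ENNReal.ofReal (K ^ 2 + n * ∫ ω, excess K (θ ω) ∂μ) := by
  have hi : ∀ j, Integrable (fun ω => excess K (θ (T^[j] ω))) μ := fun j =>
    integrable_excess (hθ.comp_measurePreserving (hT.iterate j)) K
  have hI := (integrable_const (K ^ 2)).add
    (integrable_finsetSum (Finset.Icc 1 n) fun j _ => hi j)
  have hnn : ∀ ω, 0 ≤ ∑ j ∈ Finset.Icc 1 n, excess K (θ (T^[j] ω)) := fun ω =>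
    Finset.sum_nonneg fun j _ => excess_nonneg _ _
  calc _ ≤ ∫⁻ ω, ENNReal.ofReal (K ^ 2 + ∑ j ∈ Finset.Icc 1 n, excess K (θ (T^[j] ω))) ∂μ := by
        refine lintegral_mono fun ω => iSup₂_le fun j hj => ?_
        rw [enorm_sq_eq_ofReal]
        refine ENNReal.ofReal_le_ofReal ?_
        have h1 := Finset.single_le_sum
          (fun j _ => excess_nonneg K (θ (T^[j] ω))) hj
        have h2 := sq_sub_sq_le_excess K (θ (T^[j] ω))
        linarith
    _ = ENNReal.ofReal (∫ ω, (K ^ 2 + ∑ j ∈ Finset.Icc 1 n, excess K (θ (T^[j] ω))) ∂μ) :=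
        (ofReal_integral_eq_lintegral_ofReal hI
          (ae_of_all _ fun ω => add_nonneg (sq_nonneg K) (hnn ω))).symm
    _ = _ := by
        rw [integral_add (integrable_const _)
          (integrable_finsetSum (Finset.Icc 1 n) fun j _ => hi j),
          integral_finsetSum _ fun j _ => hi j,
          Finset.sum_congr rfl fun j _ => integral_comp_of_measurePreserving (hT.iterate j)
            (integrable_excess hθ K).aestronglyMeasurable]
        simp

/-- The sums telescope to `θ - θ ∘ T^j`. Fixing `K` first makes the expected excess small; then `K²`
and `E θ²` are negligible against `n`. -/
lemma eventually_maxSq_coboundary_le [IsProbabilityMeasure μ] (hT : MeasurePreserving T μ μ)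
    {θ : Ω → ℝ} (hθm : Measurable θ) (hθ : MemLp θ 2 μ) {ε : ℝ} (hε : 0 < ε) :
    ∀ᶠ n : ℕ in atTop, maxSq μ T (fun ω => θ ω - θ (T ω)) n ≤ ENNReal.ofReal (n * ε) := by
  obtain ⟨K, hK⟩ := ((tendsto_integral_excess hθ).eventually_lt_const
    (show (0 : ℝ) < ε / 4 by positivity)).exists
  have hlim : Tendsto (fun n : ℕ => (n : ℝ) * (ε / 2)) atTop atTop :=
    tendsto_natCast_atTop_atTop.atTop_mul_const (by positivity)
  filter_upwards [hlim.eventually_ge_atTop (2 * ∫ ω, θ ω ^ 2 ∂μ + 2 * (K : ℝ) ^ 2)] with n hn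
  have htel : ∀ j ω, ∑ i ∈ Finset.range j, (θ (T^[i] ω) - θ (T (T^[i] ω))) =
      θ ω + -θ (T^[j] ω) := by
    intro j ω
    simp only [← Function.iterate_succ_apply']
    rw [Finset.sum_range_sub' (fun i => θ (T^[i] ω)), sub_eq_add_neg, Function.iterate_zero_apply]
  simp only [maxSq, htel]
  refine (lintegral_iSup_enorm_add_sq_le (fun _ => hθm) n).trans ?_
  have h1 : ∫⁻ ω, ⨆ j ∈ Finset.Icc 1 n, ‖θ ω‖ₑ ^ 2 ∂μ ≤ ENNReal.ofReal (∫ ω, θ ω ^ 2 ∂μ) := by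
    rw [← lintegral_enorm_sq hθ]
    exact lintegral_mono fun ω => iSup₂_le fun _ _ => le_rfl
  have h2 := lintegral_iSup_enorm_iterate_sq_le hT hθ K n
  simp only [enorm_neg]
  refine (add_le_add (mul_le_mul_right h1 2) (mul_le_mul_right h2 2)).trans ?_
  have h3 : 0 ≤ ∫ ω, θ ω ^ 2 ∂μ := integral_nonneg fun ω => sq_nonneg _
  have h4 : 0 ≤ ∫ ω, excess K (θ ω) ∂μ := integral_nonneg fun ω => excess_nonneg _ _
  rw [← ENNReal.ofReal_ofNat 2, ← ENNReal.ofReal_mul (by norm_num),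
    ← ENNReal.ofReal_mul (by norm_num), ← ENNReal.ofReal_add (by positivity) (by positivity)]
  refine ENNReal.ofReal_le_ofReal ?_
  have h5 : (n : ℝ) * ∫ ω, excess K (θ ω) ∂μ ≤ n * (ε / 4) := by gcongr
  linarith

end MaximalSquare

/-! ### Stationary martingale differences -/

section MartingaleDifference

variable {Ω : Type*} {G m : MeasurableSpace Ω} {μ : Measure Ω} {T : Ω → Ω}

lemma le_comap_iterate (hG : G ≤ G.comap T) (k : ℕ) : G ≤ G.comap (T^[k]) := by
  have h := comap_iterate_mono hG (Nat.zero_le k)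
  simpa using h

lemma exists_memLp_comp (hT : MeasurePreserving T μ μ) (hGm : G ≤ m) {W : Ω → ℝ}
    (hW : Measurable[G.comap T] W) (hW2 : MemLp W 2 μ) :
    ∃ V : Ω → ℝ, Measurable[G] V ∧ MemLp V 2 μ ∧ W = fun ω => V (T ω) := by
  obtain ⟨V, hV, rfl⟩ := exists_measurable_comp hW
  refine ⟨V, hV, ?_, rfl⟩
  rw [← hT.map_eq]
  exact (memLp_map_measure_iff (hV.mono hGm le_rfl).aestronglyMeasurable
    hT.measurable.aemeasurable).2 hW2

/-- Since `G ≤ T^{-k} G`, the weight factors as `W = V ∘ T^k`, and invariance removes `T^k` from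
both sides. -/
lemma integral_mul_comp_iterate (hT : MeasurePreserving T μ μ) (hGm : G ≤ m)
    (hG : G ≤ G.comap T) {W h h' : Ω → ℝ} (hW : Measurable[G] W) (hW2 : MemLp W 2 μ)
    (hh : MemLp h 2 μ) (hh' : MemLp h' 2 μ)
    (hproj : ∀ V : Ω → ℝ, Measurable[G] V → MemLp V 2 μ →
      ∫ ω, V ω * h ω ∂μ = ∫ ω, V ω * h' ω ∂μ) (k : ℕ) :
    ∫ ω, W ω * h (T^[k] ω) ∂μ = ∫ ω, W ω * h' (T^[k] ω) ∂μ := by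
  obtain ⟨V, hV, hV2, rfl⟩ := exists_memLp_comp (hT.iterate k) hGm
    (hW.mono (le_comap_iterate hG k) le_rfl) hW2
  have h1 := integral_comp_of_measurePreserving (hT.iterate k)
    (hV2.integrable_mul hh).aestronglyMeasurable
  have h2 := integral_comp_of_measurePreserving (hT.iterate k)
    (hV2.integrable_mul hh').aestronglyMeasurable
  simp only [Pi.mul_apply] at h1 h2
  rw [h1, h2, hproj V hV hV2]

lemma integral_mul_eq_integral_mul_condExp [IsProbabilityMeasure μ] (hGm : G ≤ m) {V h : Ω → ℝ}
    (hV : Measurable[G] V) (hV2 : MemLp V 2 μ) (hh : MemLp h 2 μ) :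
    ∫ ω, V ω * (μ[h|G]) ω ∂μ = ∫ ω, V ω * h ω ∂μ := by
  have h1 := condExp_mul_of_stronglyMeasurable_left (μ := μ) hV.stronglyMeasurable
    (hV2.integrable_mul hh) (hh.integrable one_le_two)
  have h2 := integral_condExp (μ := μ) hGm (f := V * h)
  rw [integral_congr_ae h1] at h2
  exact h2

/-- `δ` is a martingale difference for the `σ`-field `G`: it is measurable one step later, square
integrable, and its conditional expectation given `G` vanishes. -/
structure IsMartingaleDifference {m : MeasurableSpace Ω} (μ : Measure Ω) (T : Ω → Ω)
    (G : MeasurableSpace Ω) (δ : Ω → ℝ) : Prop where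
  measurable : Measurable[G.comap T] δ
  memLp : MemLp δ 2 μ
  setIntegral_eq_zero : ∀ A, MeasurableSet[G] A → ∫ ω in A, δ ω ∂μ = 0

lemma IsMartingaleDifference.sub {δ δ' : Ω → ℝ} [IsProbabilityMeasure μ]
    (h : IsMartingaleDifference μ T G δ)
    (h' : IsMartingaleDifference μ T G δ') :
    IsMartingaleDifference μ T G (fun ω => δ ω - δ' ω) where
  measurable := h.measurable.sub h'.measurable
  memLp := h.memLp.sub h'.memLp
  setIntegral_eq_zero A hA := by
    rw [integral_sub (h.memLp.integrable one_le_two).integrableOn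
      (h'.memLp.integrable one_le_two).integrableOn, h.setIntegral_eq_zero A hA,
      h'.setIntegral_eq_zero A hA, sub_zero]

lemma IsMartingaleDifference.integral_mul_eq_zero [IsProbabilityMeasure μ] {δ : Ω → ℝ}
    (h : IsMartingaleDifference μ T G δ) (hGm : G ≤ m)
    {V : Ω → ℝ} (hV : Measurable[G] V) (hV2 : MemLp V 2 μ) : ∫ ω, V ω * δ ω ∂μ = 0 := by
  have hint := h.memLp.integrable one_le_two
  have h0 : (fun _ => (0 : ℝ)) =ᵐ[μ] μ[δ|G] :=
    ae_eq_condExp_of_forall_setIntegral_eq hGm hint (fun _ _ _ => integrableOn_zero)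
      (fun A hA _ => by simp [h.setIntegral_eq_zero A hA]) aestronglyMeasurable_const
  rw [← integral_mul_eq_integral_mul_condExp hGm hV hV2 h.memLp,
    integral_congr_ae (g := fun _ => (0 : ℝ)) (h0.mono fun ω hω => by
      change V ω * (μ[δ|G]) ω = 0
      rw [← hω, mul_zero])]
  simp

lemma IsMartingaleDifference.integral_mul_iterate_eq_zero [IsProbabilityMeasure μ] {δ : Ω → ℝ}
    (h : IsMartingaleDifference μ T G δ) (hT : MeasurePreserving T μ μ) (hGm : G ≤ m)
    (hG : G ≤ G.comap T) {W : Ω → ℝ} (hW : Measurable[G.comap T] W) (hW2 : MemLp W 2 μ) (l : ℕ) :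
    ∫ ω, W ω * δ (T^[l + 1] ω) ∂μ = 0 := by
  obtain ⟨V, hV, hV2, rfl⟩ := exists_memLp_comp hT hGm hW hW2
  have h1 := integral_mul_comp_iterate hT hGm hG (h' := fun _ => 0) hV hV2 h.memLp MemLp.zero
    (fun V hV hV2 => by simp [h.integral_mul_eq_zero hGm hV hV2]) l
  have h2 := integral_comp_of_measurePreserving hT
    (hV2.integrable_mul (h.memLp.comp_measurePreserving (hT.iterate l))).aestronglyMeasurable
  simp only [Pi.mul_apply, Function.comp_apply, ← Function.iterate_succ_apply] at h2
  rw [h2, h1]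
  simp

lemma IsMartingaleDifference.maxSq_le [IsProbabilityMeasure μ] {δ : Ω → ℝ}
    (h : IsMartingaleDifference μ T G δ) (hT : MeasurePreserving T μ μ) (hGm : G ≤ m)
    (hG : G ≤ G.comap T) (n : ℕ) :
    maxSq μ T δ n ≤ ENNReal.ofReal (n * (8 * ∫ ω, δ ω ^ 2 ∂μ)) := by
  have hGT : G.comap T ≤ m := (MeasurableSpace.comap_mono hGm).trans hT.measurable.comap_le
  -- The field is `G.comap T`, since `δ` is measurable only one step later; orthogonality allows `b
  -- = 0`.
  refine (lintegral_iSup_sq_sum_iterate_le hT hGT (MeasurableSpace.comap_mono hG) h.measurable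
    h.memLp le_rfl (b := 0) (fun N W hW hW2 _ => le_of_eq ?_) n).trans_eq (by simp)
  rw [integral_mul_sum (h := fun l ω => δ (T^[l + 1] ω)) hW2 fun l =>
    h.memLp.comp_measurePreserving (hT.iterate (l + 1))]
  exact Finset.sum_eq_zero fun l _ => h.integral_mul_iterate_eq_zero hT hGm hG hW hW2 l

/-- Splitting off the first term, the sum is `δ + R ∘ T`, and `δ` is orthogonal to every later
difference. -/
lemma IsMartingaleDifference.integral_sq_sum [IsProbabilityMeasure μ] {δ : Ω → ℝ}
    (h : IsMartingaleDifference μ T G δ) (hT : MeasurePreserving T μ μ) (hGm : G ≤ m)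
    (hG : G ≤ G.comap T) (n : ℕ) :
    ∫ ω, (∑ i ∈ Finset.range n, δ (T^[i] ω)) ^ 2 ∂μ = n * ∫ ω, δ ω ^ 2 ∂μ := by
  have hk : ∀ k, MemLp (fun ω => δ (T^[k] ω)) 2 μ := fun k =>
    h.memLp.comp_measurePreserving (hT.iterate k)
  induction n with
  | zero => simp
  | succ n ih =>
    set R : Ω → ℝ := fun ω => ∑ i ∈ Finset.range n, δ (T^[i] ω) with hR
    have hR2 : MemLp R 2 μ := memLp_finsetSum _ fun i _ => hk i
    have hRT : MemLp (fun ω => R (T ω)) 2 μ := hR2.comp_measurePreserving hT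
    have e : ∀ ω, (∑ i ∈ Finset.range (n + 1), δ (T^[i] ω)) ^ 2 =
        R (T ω) ^ 2 + (2 * (δ ω * R (T ω)) + δ ω ^ 2) := by
      intro ω
      rw [Finset.sum_range_succ']
      simp only [hR, ← Function.iterate_succ_apply, Function.iterate_zero_apply]
      ring
    have e1 := integral_comp_of_measurePreserving hT hR2.integrable_sq.aestronglyMeasurable
    have e2 : ∫ ω, δ ω * R (T ω) ∂μ = 0 := by
      simp only [hR, ← Function.iterate_succ_apply]
      rw [integral_mul_sum h.memLp fun l => hk (l + 1)]
      exact Finset.sum_eq_zero fun l _ =>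
        h.integral_mul_iterate_eq_zero hT hGm hG h.measurable h.memLp l
    have i1 : Integrable (fun ω => 2 * (δ ω * R (T ω))) μ :=
      (h.memLp.integrable_mul hRT).const_mul 2
    simp only [e]
    rw [integral_add hRT.integrable_sq, integral_add i1 h.memLp.integrable_sq,
      integral_const_mul, e2, e1, ih]
    · push_cast; ring
    · exact i1.add h.memLp.integrable_sq

lemma IsMartingaleDifference.le_maxSq [IsProbabilityMeasure μ] {δ : Ω → ℝ}
    (h : IsMartingaleDifference μ T G δ) (hT : MeasurePreserving T μ μ) (hGm : G ≤ m)
    (hG : G ≤ G.comap T) {n : ℕ} (hn : 1 ≤ n) :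
    ENNReal.ofReal (n * ∫ ω, δ ω ^ 2 ∂μ) ≤ maxSq μ T δ n := by
  have hk : MemLp (fun ω => ∑ i ∈ Finset.range n, δ (T^[i] ω)) 2 μ :=
    memLp_finsetSum _ fun i _ => h.memLp.comp_measurePreserving (hT.iterate i)
  rw [← h.integral_sq_sum hT hGm hG, ← lintegral_enorm_sq hk]
  exact lintegral_mono fun ω => le_iSup₂
    (f := fun j (_ : j ∈ Finset.Icc 1 n) => ‖∑ i ∈ Finset.range j, δ (T^[i] ω)‖ₑ ^ 2) n
    (Finset.mem_Icc.2 ⟨hn, le_rfl⟩)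

end MartingaleDifference

/-! ### Approximation at a finite horizon -/

section Approximation

variable {Ω : Type*} {G m : MeasurableSpace Ω} {μ : Measure Ω} {T : Ω → Ω} {f : Ω → ℝ}

/-- The prediction `E [f ∘ T^i | G]`. -/
noncomputable def prediction {m : MeasurableSpace Ω} (μ : Measure Ω) (T : Ω → Ω)
    (G : MeasurableSpace Ω) (f : Ω → ℝ) (i : ℕ) : Ω → ℝ :=
  μ[fun ω => f (T^[i] ω)|G]

/-- The average of the predictions `1, …, p` steps ahead. -/
noncomputable def averagePrediction {m : MeasurableSpace Ω} (μ : Measure Ω) (T : Ω → Ω)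
    (G : MeasurableSpace Ω) (f : Ω → ℝ) (p : ℕ) (ω : Ω) : ℝ :=
  (p : ℝ)⁻¹ * ∑ i ∈ Finset.range p, prediction μ T G f (i + 1) ω

/-- The average over `j < p` of the predictions of `∑_{i ≤ j} f ∘ T^i`. -/
noncomputable def corrector {m : MeasurableSpace Ω} (μ : Measure Ω) (T : Ω → Ω)
    (G : MeasurableSpace Ω) (f : Ω → ℝ) (p : ℕ) (ω : Ω) : ℝ :=
  (p : ℝ)⁻¹ * ∑ j ∈ Finset.range p, ∑ i ∈ Finset.range (j + 1), prediction μ T G f i ω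

/-- The martingale difference of the `p`-th approximation. -/
noncomputable def approxDifference {m : MeasurableSpace Ω} (μ : Measure Ω) (T : Ω → Ω)
    (G : MeasurableSpace Ω) (f : Ω → ℝ) (p : ℕ) (ω : Ω) : ℝ :=
  f ω - averagePrediction μ T G f p ω - corrector μ T G f p ω + corrector μ T G f p (T ω)

lemma measurable_prediction (i : ℕ) : Measurable[G] (prediction μ T G f i) :=
  stronglyMeasurable_condExp.measurable

lemma measurable_averagePrediction (p : ℕ) : Measurable[G] (averagePrediction μ T G f p) :=
  (Finset.measurable_fun_sum _ fun i _ => measurable_prediction (i + 1)).const_mul _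

lemma measurable_corrector (p : ℕ) : Measurable[G] (corrector μ T G f p) :=
  (Finset.measurable_fun_sum _ fun _ _ =>
    Finset.measurable_fun_sum _ fun i _ => measurable_prediction i).const_mul _

lemma measurable_approxDifference (hf : Measurable[G] f) (hG : G ≤ G.comap T) (p : ℕ) :
    Measurable[G.comap T] (approxDifference μ T G f p) :=
  ((((hf.sub (measurable_averagePrediction p)).sub (measurable_corrector p))).mono hG le_rfl).add
    (@Measurable.comp _ _ _ (G.comap T) G _ _ _ (measurable_corrector p) (comap_measurable T))

lemma memLp_prediction (hT : MeasurePreserving T μ μ) (hf2 : MemLp f 2 μ) (i : ℕ) :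
    MemLp (prediction μ T G f i) 2 μ :=
  (hf2.comp_measurePreserving (hT.iterate i)).condExp one_le_two

lemma memLp_averagePrediction (hT : MeasurePreserving T μ μ) (hf2 : MemLp f 2 μ) (p : ℕ) :
    MemLp (averagePrediction μ T G f p) 2 μ :=
  (memLp_finsetSum _ fun i _ => memLp_prediction hT hf2 (i + 1)).const_mul _

lemma memLp_corrector (hT : MeasurePreserving T μ μ) (hf2 : MemLp f 2 μ) (p : ℕ) :
    MemLp (corrector μ T G f p) 2 μ :=
  (memLp_finsetSum _ fun _ _ => memLp_finsetSum _ fun i _ => memLp_prediction hT hf2 i).const_mul _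

/-- The correlations of `f ∘ T^(q+1)` with those `G`-measurable variables whose tails are
dominated by those of `f` are bounded by `a q`. -/
def CorrelationBound {m : MeasurableSpace Ω} (μ : Measure Ω) (T : Ω → Ω)
    (G : MeasurableSpace Ω) (f : Ω → ℝ) (a : ℕ → ℝ) : Prop :=
  ∀ W : Ω → ℝ, Measurable[G] W → MemLp W 2 μ →
    (∀ t, 0 ≤ t → ∫ ω, excess t (W ω) ∂μ ≤ ∫ ω, excess t (f ω) ∂μ) →
    ∀ q : ℕ, |∫ ω, W ω * f (T^[q + 1] ω) ∂μ| ≤ a q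

lemma CorrelationBound.nonneg {a : ℕ → ℝ} (h : CorrelationBound μ T G f a) (q : ℕ) : 0 ≤ a q := by
  simpa using h (fun _ => 0) measurable_const MemLp.zero (fun t _ => by
    have h0 : excess t 0 = 0 := max_eq_right (by nlinarith [sq_nonneg t])
    simpa [h0] using integral_nonneg (μ := μ) (f := fun ω => excess t (f ω))
      fun ω => excess_nonneg t (f ω)) q

lemma memLp_approxDifference (hT : MeasurePreserving T μ μ) (hf2 : MemLp f 2 μ) (p : ℕ) :
    MemLp (approxDifference μ T G f p) 2 μ :=
  ((hf2.sub (memLp_averagePrediction hT hf2 p)).sub (memLp_corrector hT hf2 p)).add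
    ((memLp_corrector hT hf2 p).comp_measurePreserving hT)

variable [IsProbabilityMeasure μ]

lemma integral_mul_prediction (hT : MeasurePreserving T μ μ) (hGm : G ≤ m) (hf2 : MemLp f 2 μ)
    {V : Ω → ℝ} (hV : Measurable[G] V) (hV2 : MemLp V 2 μ) (i : ℕ) :
    ∫ ω, V ω * prediction μ T G f i ω ∂μ = ∫ ω, V ω * f (T^[i] ω) ∂μ :=
  integral_mul_eq_integral_mul_condExp hGm hV hV2 (hf2.comp_measurePreserving (hT.iterate i))

lemma setIntegral_prediction (hT : MeasurePreserving T μ μ) (hGm : G ≤ m) (hf2 : MemLp f 2 μ)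
    {A : Set Ω} (hA : MeasurableSet[G] A) (i : ℕ) :
    ∫ ω in A, prediction μ T G f i ω ∂μ = ∫ ω in A, f (T^[i] ω) ∂μ :=
  setIntegral_condExp hGm
    ((hf2.comp_measurePreserving (hT.iterate i)).integrable one_le_two) hA

lemma setIntegral_prediction_comp (hT : MeasurePreserving T μ μ) (hGm : G ≤ m)
    (hG : G ≤ G.comap T) (hf2 : MemLp f 2 μ) {A : Set Ω} (hA : MeasurableSet[G] A) (i : ℕ) :
    ∫ ω in A, prediction μ T G f i (T ω) ∂μ = ∫ ω in A, f (T^[i + 1] ω) ∂μ := by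
  obtain ⟨B, hB, rfl⟩ := hG A hA
  rw [setIntegral_comp_of_measurePreserving hT (hGm B hB) (memLp_prediction hT hf2 i).1,
    setIntegral_prediction hT hGm hf2 hB,
    ← setIntegral_comp_of_measurePreserving hT (hGm B hB) (h := fun ω => f (T^[i] ω))
      (hf2.comp_measurePreserving (hT.iterate i)).1]
  rfl

/-- Passing from `C_p` to `C_p ∘ T` moves every prediction one step ahead, so the inner sums
telescope to `I (j + 1) - I 0`. Their average cancels the contribution of `f - A_p`. -/
lemma setIntegral_approxDifference (hT : MeasurePreserving T μ μ) (hGm : G ≤ m)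
    (hG : G ≤ G.comap T) (hf2 : MemLp f 2 μ) {p : ℕ} (hp : p ≠ 0)
    {A : Set Ω} (hA : MeasurableSet[G] A) :
    ∫ ω in A, approxDifference μ T G f p ω ∂μ = 0 := by
  have hi {h : Ω → ℝ} (hh : MemLp h 2 μ) : Integrable h (μ.restrict A) :=
    (hh.integrable one_le_two).integrableOn
  have hp2 := fun i => hi (memLp_prediction (G := G) hT hf2 i)
  have hpT : ∀ i, Integrable (fun ω => prediction μ T G f i (T ω)) (μ.restrict A) := fun i => hi ((memLp_prediction (G := G) hT hf2 i).comp_measurePreserving hT)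
  have hcT := (memLp_corrector (G := G) hT hf2 p).comp_measurePreserving hT
  have ha2 := memLp_averagePrediction (G := G) hT hf2 p
  have hc2 := memLp_corrector (G := G) hT hf2 p
  set I : ℕ → ℝ := fun i => ∫ ω in A, f (T^[i] ω) ∂μ with hI
  have e1 : ∫ ω in A, averagePrediction μ T G f p ω ∂μ =
      (p : ℝ)⁻¹ * ∑ i ∈ Finset.range p, I (i + 1) := by
    simp only [averagePrediction]
    rw [integral_const_mul, integral_finsetSum _ fun i _ => hp2 (i + 1)]
    simp only [setIntegral_prediction hT hGm hf2 hA, hI]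
  have e2 : ∫ ω in A, corrector μ T G f p ω ∂μ =
      (p : ℝ)⁻¹ * ∑ j ∈ Finset.range p, ∑ i ∈ Finset.range (j + 1), I i := by
    simp only [corrector]
    rw [integral_const_mul, integral_finsetSum _ fun j _ => integrable_finsetSum _ fun i _ => hp2 i]
    simp only [integral_finsetSum _ fun i _ => hp2 i, setIntegral_prediction hT hGm hf2 hA, hI]
  have e3 : ∫ ω in A, corrector μ T G f p (T ω) ∂μ =
      (p : ℝ)⁻¹ * ∑ j ∈ Finset.range p, ∑ i ∈ Finset.range (j + 1), I (i + 1) := by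
    simp only [corrector]
    rw [integral_const_mul, integral_finsetSum _ fun j _ => integrable_finsetSum _ fun i _ => hpT i]
    simp only [integral_finsetSum _ fun i _ => hpT i,
      setIntegral_prediction_comp hT hGm hG hf2 hA, hI]
  have e4 : ∫ ω in A, approxDifference μ T G f p ω ∂μ = I 0 -
      ∫ ω in A, averagePrediction μ T G f p ω ∂μ - ∫ ω in A, corrector μ T G f p ω ∂μ +
      ∫ ω in A, corrector μ T G f p (T ω) ∂μ := by
    have a1 := integral_add (hi ((hf2.sub ha2).sub hc2)) (hi hcT)
    have a2 := integral_sub (hi (hf2.sub ha2)) (hi hc2)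
    have a3 := integral_sub (hi hf2) (hi ha2)
    simp only [Pi.sub_apply, Function.comp_apply] at a1 a2 a3
    simp only [approxDifference]
    rw [a1, a2, a3]
    simp [hI]
  have e5 : ∑ j ∈ Finset.range p, ∑ i ∈ Finset.range (j + 1), I (i + 1) -
      ∑ j ∈ Finset.range p, ∑ i ∈ Finset.range (j + 1), I i =
      ∑ j ∈ Finset.range p, I (j + 1) - p * I 0 := by
    rw [← Finset.sum_sub_distrib, Finset.sum_congr rfl fun j _ =>
      (Finset.sum_sub_distrib (s := Finset.range (j + 1)) (fun i => I (i + 1)) I).symm.trans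
        (Finset.sum_range_sub I (j + 1))]
    simp
  have hp0 : (p : ℝ) ≠ 0 := by exact_mod_cast hp
  rw [e4, e1, e2, e3]
  field_simp
  linarith

lemma isMartingaleDifference_approxDifference (hT : MeasurePreserving T μ μ) (hGm : G ≤ m)
    (hG : G ≤ G.comap T) (hf : Measurable[G] f) (hf2 : MemLp f 2 μ) {p : ℕ} (hp : p ≠ 0) :
    IsMartingaleDifference μ T G (approxDifference μ T G f p) where
  measurable := measurable_approxDifference hf hG p
  memLp := memLp_approxDifference hT hf2 p
  setIntegral_eq_zero _ hA := setIntegral_approxDifference hT hGm hG hf2 hp hA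

/-- Conditional Jensen by a tangent line: `2 V` is a subgradient of `excess t` at `g`, and being
`G`-measurable it integrates `f ∘ T^i` and `g` alike. -/
lemma integral_excess_prediction_le (hT : MeasurePreserving T μ μ) (hGm : G ≤ m)
    (hf2 : MemLp f 2 μ) {t : ℝ} (ht : 0 ≤ t) (i : ℕ) :
    ∫ ω, excess t (prediction μ T G f i ω) ∂μ ≤ ∫ ω, excess t (f ω) ∂μ := by
  set g := prediction μ T G f i with hg
  have hgm : Measurable[G] g := measurable_prediction i
  have hg2 : MemLp g 2 μ := memLp_prediction hT hf2 i
  have hfi : MemLp (fun ω => f (T^[i] ω)) 2 μ := hf2.comp_measurePreserving (hT.iterate i)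
  have hA : MeasurableSet[G] {ω | t < |g ω|} :=
    measurableSet_lt measurable_const (continuous_abs.measurable.comp hgm)
  set V : Ω → ℝ := Set.indicator {ω | t < |g ω|} g with hV
  have hVm : Measurable[G] V := hgm.indicator hA
  have hVg : ∀ ω, |V ω| ≤ |g ω| := fun ω => by
    by_cases h : t < |g ω| <;> simp [hV, h]
  have hV2 : MemLp V 2 μ := memLp_of_abs_le hg2 (hVm.mono hGm le_rfl) hVg
  have h1 := integral_mul_prediction hT hGm hf2 hVm hV2 i
  have hpt : ∀ ω, excess t (g ω) + 2 * (V ω * f (T^[i] ω)) ≤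
      2 * (V ω * g ω) + excess t (f (T^[i] ω)) := by
    intro ω
    have h2 := excess_nonneg t (f (T^[i] ω))
    have h3 := sq_sub_sq_le_excess t (f (T^[i] ω))
    by_cases h : t < |g ω|
    · have hVω : V ω = g ω := by simp [hV, h]
      have h4 : excess t (g ω) = g ω ^ 2 - t ^ 2 :=
        max_eq_left (sub_nonneg.2 (sq_le_sq.2 (by rw [abs_of_nonneg ht]; exact h.le)))
      rw [hVω, h4]
      nlinarith [sq_nonneg (g ω - f (T^[i] ω))]
    · have hVω : V ω = 0 := by simp [hV, h]
      have h4 : excess t (g ω) = 0 :=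
        max_eq_right (sub_nonpos.2 (sq_le_sq.2 (by rw [abs_of_nonneg ht]; exact not_lt.1 h)))
      rw [hVω, h4]
      linarith
  have i1 : Integrable (fun ω => 2 * (V ω * f (T^[i] ω))) μ := (hV2.integrable_mul hfi).const_mul 2
  have i2 : Integrable (fun ω => 2 * (V ω * g ω)) μ := (hV2.integrable_mul hg2).const_mul 2
  have h5 := integral_mono ((integrable_excess hg2 t).add i1) (i2.add (integrable_excess hfi t)) hpt
  simp only [Pi.add_apply] at h5
  rw [integral_add (integrable_excess hg2 t) i1, integral_add i2 (integrable_excess hfi t),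
    integral_const_mul, integral_const_mul, ← h1,
    integral_comp_of_measurePreserving (hT.iterate i)
      (integrable_excess hf2 t).aestronglyMeasurable] at h5
  linarith

lemma integral_excess_averagePrediction_le (hT : MeasurePreserving T μ μ) (hGm : G ≤ m)
    (hf2 : MemLp f 2 μ) {t : ℝ} (ht : 0 ≤ t) {p : ℕ} (hp : p ≠ 0) :
    ∫ ω, excess t (averagePrediction μ T G f p ω) ∂μ ≤ ∫ ω, excess t (f ω) ∂μ := by
  have hi : ∀ i, Integrable (fun ω => excess t (prediction μ T G f i ω)) μ := fun i =>
    integrable_excess (memLp_prediction hT hf2 i) t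
  refine (integral_mono (integrable_excess (memLp_averagePrediction hT hf2 p) t)
    ((integrable_finsetSum (Finset.range p) fun i _ => hi (i + 1)).const_mul (p : ℝ)⁻¹)
    fun ω => excess_average_le t hp _).trans ?_
  rw [integral_const_mul, integral_finsetSum _ fun i _ => hi (i + 1)]
  have hp0 : (0 : ℝ) < p := by positivity
  rw [inv_mul_le_iff₀ hp0]
  simpa using Finset.sum_le_card_nsmul (Finset.range p) _ _ fun i _ =>
    integral_excess_prediction_le hT hGm hf2 ht (i + 1)

/-- The Cesàro means of the tails of a series. -/
noncomputable def meanTail (a : ℕ → ℝ) (p : ℕ) : ℝ :=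
  (p : ℝ)⁻¹ * ∑ i ∈ Finset.range p, ∑' l, a (l + i)

lemma tendsto_meanTail (a : ℕ → ℝ) : Tendsto (meanTail a) atTop (𝓝 0) :=
  (tendsto_sum_nat_add a).cesaro

lemma meanTail_nonneg {a : ℕ → ℝ} (ha : ∀ i, 0 ≤ a i) (p : ℕ) : 0 ≤ meanTail a p :=
  mul_nonneg (by positivity) (Finset.sum_nonneg fun i _ => tsum_nonneg fun l => ha _)

lemma integral_mul_averagePrediction_iterate (hT : MeasurePreserving T μ μ) (hGm : G ≤ m)
    (hG : G ≤ G.comap T) (hf2 : MemLp f 2 μ) {W : Ω → ℝ} (hW : Measurable[G] W)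
    (hW2 : MemLp W 2 μ) (p k : ℕ) :
    ∫ ω, W ω * averagePrediction μ T G f p (T^[k] ω) ∂μ =
      (p : ℝ)⁻¹ * ∑ i ∈ Finset.range p, ∫ ω, W ω * f (T^[k + i + 1] ω) ∂μ := by
  have hk := hT.iterate k
  simp only [averagePrediction, mul_left_comm (_ : ℝ) (p : ℝ)⁻¹]
  rw [integral_const_mul, integral_mul_sum
    (h := fun i ω => prediction μ T G f (i + 1) (T^[k] ω)) hW2 fun i =>
      (memLp_prediction hT hf2 (i + 1)).comp_measurePreserving hk]
  congr 1
  refine Finset.sum_congr rfl fun i _ => ?_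
  rw [integral_mul_comp_iterate hT hGm hG hW hW2 (memLp_prediction hT hf2 (i + 1))
    (hf2.comp_measurePreserving (hT.iterate (i + 1)))
    (fun V hV hV2 => integral_mul_prediction hT hGm hf2 hV hV2 (i + 1)) k]
  refine integral_congr_ae (ae_of_all _ fun ω => ?_)
  simp only [Function.comp_apply]
  rw [← Function.iterate_add_apply, show i + 1 + k = k + i + 1 by omega]

/-- The maximal inequality with `b = c = meanTail a p`, whence `8 + 24 = 32`. Anything dominated by
`A_p` inherits its tail bound, so `hcorr` covers every admissible `W`. -/
lemma maxSq_averagePrediction_le (hT : MeasurePreserving T μ μ) (hGm : G ≤ m)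
    (hG : G ≤ G.comap T) (hf2 : MemLp f 2 μ) {a : ℕ → ℝ} (ha : Summable a)
    (hcorr : CorrelationBound μ T G f a) {p : ℕ} (hp : p ≠ 0) (n : ℕ) :
    maxSq μ T (averagePrediction μ T G f p) n ≤ ENNReal.ofReal (n * (32 * meanTail a p)) := by
  have ha0 := hcorr.nonneg
  have hy2 := memLp_averagePrediction (G := G) hT hf2 p
  have hym := measurable_averagePrediction (μ := μ) (T := T) (G := G) (f := f) p
  have hp0 : (0 : ℝ) ≤ (p : ℝ)⁻¹ := by positivity
  have hdom : ∀ W : Ω → ℝ, MemLp W 2 μ → (∀ ω, |W ω| ≤ |averagePrediction μ T G f p ω|) →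
      ∀ t, 0 ≤ t → ∫ ω, excess t (W ω) ∂μ ≤ ∫ ω, excess t (f ω) ∂μ := fun W hW2 hWy t ht =>
    (integral_mono (integrable_excess hW2 t) (integrable_excess hy2 t) fun ω =>
      excess_le_excess (hWy ω)).trans (integral_excess_averagePrediction_le hT hGm hf2 ht hp)
  have hsum : ∀ i, Summable fun l => a (l + i) := fun i => (summable_nat_add_iff i).2 ha
  have hc : ∫ ω, averagePrediction μ T G f p ω ^ 2 ∂μ ≤ meanTail a p := by
    have h1 := integral_mul_averagePrediction_iterate hT hGm hG hf2 hym hy2 p 0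
    simp only [Function.iterate_zero_apply, ← sq] at h1
    rw [h1, meanTail]
    gcongr with i hi
    refine ((le_abs_self _).trans (hcorr _ hym hy2 (hdom _ hy2 fun _ => le_rfl) (0 + i))).trans ?_
    exact (hsum i).le_tsum 0 fun l _ => ha0 _
  refine (lintegral_iSup_sq_sum_iterate_le hT hGm hG hym hy2 hc (b := meanTail a p)
    (fun N W hW hW2 hWy => ?_) n).trans_eq (by ring_nf)
  rw [integral_mul_sum (h := fun l ω => averagePrediction μ T G f p (T^[l + 1] ω)) hW2 fun l =>
    hy2.comp_measurePreserving (hT.iterate (l + 1))]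
  simp only [integral_mul_averagePrediction_iterate hT hGm hG hf2 hW hW2]
  rw [← Finset.mul_sum, Finset.sum_comm, meanTail]
  gcongr with i hi
  calc _ ≤ ∑ l ∈ Finset.range N, a (l + 1 + i) := Finset.sum_le_sum fun l _ =>
        (le_abs_self _).trans (hcorr W hW hW2 (hdom W hW2 hWy) (l + 1 + i))
    _ ≤ ∑ l ∈ Finset.range (N + 1), a (l + i) := by
        rw [Finset.sum_range_succ']
        exact le_add_of_nonneg_right (ha0 _)
    _ ≤ _ := (hsum i).sum_le_tsum _ fun l _ => ha0 _

lemma eventually_maxSq_sub_approxDifference_le (hT : MeasurePreserving T μ μ) (hGm : G ≤ m)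
    (hG : G ≤ G.comap T) (hf2 : MemLp f 2 μ) {a : ℕ → ℝ} (ha : Summable a)
    (hcorr : CorrelationBound μ T G f a) {p : ℕ} (hp : p ≠ 0) {ε : ℝ} (hε : 0 < ε) :
    ∀ᶠ n : ℕ in atTop, maxSq μ T (fun ω => f ω - approxDifference μ T G f p ω) n ≤
      ENNReal.ofReal (n * (64 * meanTail a p + ε)) := by
  have hr := meanTail_nonneg hcorr.nonneg p
  filter_upwards [eventually_maxSq_coboundary_le hT ((measurable_corrector p).mono hGm le_rfl)
    (memLp_corrector (G := G) hT hf2 p) (half_pos hε)] with n hn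
  have e : (fun ω => f ω - approxDifference μ T G f p ω) = fun ω =>
      averagePrediction μ T G f p ω + (corrector μ T G f p ω - corrector μ T G f p (T ω)) := by
    funext ω
    simp only [approxDifference]
    ring
  rw [e]
  refine (maxSq_add_le hT.measurable ((measurable_averagePrediction p).mono hGm le_rfl) n).trans ?_
  refine (add_le_add (mul_le_mul_right (maxSq_averagePrediction_le hT hGm hG hf2 ha hcorr hp n) 2)
    (mul_le_mul_right hn 2)).trans_eq ?_
  rw [← ENNReal.ofReal_ofNat 2, ← ENNReal.ofReal_mul (by norm_num),
    ← ENNReal.ofReal_mul (by norm_num), ← ENNReal.ofReal_add (by positivity) (by positivity)]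
  ring_nf

/-- Both differences approximate the same `f`, so the maximum for `δ_p - δ_q` is small;
orthogonality bounds it below by `n E (δ_p - δ_q)²`. Divide by `n`. -/
lemma integral_sq_approxDifference_sub_le (hT : MeasurePreserving T μ μ) (hGm : G ≤ m)
    (hG : G ≤ G.comap T) (hf : Measurable[G] f) (hf2 : MemLp f 2 μ) {a : ℕ → ℝ}
    (ha : Summable a) (hcorr : CorrelationBound μ T G f a) {p q : ℕ} (hp : p ≠ 0) (hq : q ≠ 0) :
    ∫ ω, (approxDifference μ T G f p ω - approxDifference μ T G f q ω) ^ 2 ∂μ ≤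
      128 * (meanTail a p + meanTail a q) := by
  have hrp := meanTail_nonneg hcorr.nonneg p
  have hrq := meanTail_nonneg hcorr.nonneg q
  refine le_of_forall_pos_le_add fun ε hε => ?_
  obtain ⟨n, hnp, hnq, hn⟩ := ((eventually_maxSq_sub_approxDifference_le hT hGm hG hf2 ha hcorr hp
    (show 0 < ε / 4 by positivity)).and ((eventually_maxSq_sub_approxDifference_le hT hGm hG hf2
    ha hcorr hq (show 0 < ε / 4 by positivity)).and (eventually_ge_atTop 1))).exists
  have hδ := (isMartingaleDifference_approxDifference hT hGm hG hf hf2 hp).sub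
    (isMartingaleDifference_approxDifference hT hGm hG hf hf2 hq)
  have h1 := hδ.le_maxSq hT hGm hG hn
  have hmeas : Measurable fun ω => f ω - approxDifference μ T G f q ω :=
    (hf.mono hGm le_rfl).sub ((measurable_approxDifference hf hG q).mono
      ((MeasurableSpace.comap_mono hGm).trans hT.measurable.comap_le) le_rfl)
  have e : (fun ω => approxDifference μ T G f p ω - approxDifference μ T G f q ω) = fun ω =>
      (f ω - approxDifference μ T G f q ω) + -(f ω - approxDifference μ T G f p ω) := by
    funext ω; ring
  have h2 := maxSq_add_le (μ := μ) hT.measurable hmeas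
    (v := fun ω => -(f ω - approxDifference μ T G f p ω)) n
  rw [maxSq_neg, ← e] at h2
  have h3 := (h1.trans h2).trans (add_le_add (mul_le_mul_right hnq 2) (mul_le_mul_right hnp 2))
  rw [← ENNReal.ofReal_ofNat 2, ← ENNReal.ofReal_mul (by norm_num),
    ← ENNReal.ofReal_mul (by norm_num), ← ENNReal.ofReal_add (by positivity) (by positivity),
    ENNReal.ofReal_le_ofReal_iff (by positivity)] at h3
  have hn0 : (0 : ℝ) < n := by exact_mod_cast hn
  refine le_of_mul_le_mul_left (h3.trans_eq ?_) hn0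
  ring

end Approximation

/-! ### The limiting martingale difference -/

section Limit

variable {Ω : Type*} {G m : MeasurableSpace Ω} {μ : Measure Ω} {T : Ω → Ω} {f : Ω → ℝ}

lemma eLpNorm_two_eq {h : Ω → ℝ} (hh : MemLp h 2 μ) :
    eLpNorm h 2 μ = ENNReal.ofReal (√(∫ ω, h ω ^ 2 ∂μ)) := by
  rw [hh.eLpNorm_eq_integral_rpow_norm two_ne_zero ENNReal.ofNat_ne_top, Real.sqrt_eq_rpow]
  simp

lemma exists_measurable_tendsto_integral_sq_sub [IsProbabilityMeasure μ] (hGm : G ≤ m)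
    {u : ℕ → Ω → ℝ} (hum : ∀ p, Measurable[G] (u p)) (hu : ∀ p, MemLp (u p) 2 μ) {r : ℕ → ℝ}
    (hr : Tendsto r atTop (𝓝 0)) (hur : ∀ p q, ∫ ω, (u p ω - u q ω) ^ 2 ∂μ ≤ r p + r q) :
    ∃ D : Ω → ℝ, Measurable[G] D ∧ MemLp D 2 μ ∧
      Tendsto (fun p => ∫ ω, (u p ω - D ω) ^ 2 ∂μ) atTop (𝓝 0) := by
  have hdist : ∀ {h k : Ω → ℝ} (hh : MemLp h 2 μ) (hk : MemLp k 2 μ),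
      dist (hh.toLp h) (hk.toLp k) = √(∫ ω, (h ω - k ω) ^ 2 ∂μ) := by
    intro h k hh hk
    rw [dist_eq_norm, ← MemLp.toLp_sub, Lp.norm_toLp, eLpNorm_two_eq (hh.sub hk),
      ENNReal.toReal_ofReal (Real.sqrt_nonneg _)]
    rfl
  have hcau : CauchySeq fun p => (hu p).toLp (u p) := by
    refine Metric.cauchySeq_iff.2 fun ε hε => ?_
    obtain ⟨N, hN⟩ := eventually_atTop.1
      (hr.eventually_lt_const (show (0 : ℝ) < ε ^ 2 / 2 by positivity))
    refine ⟨N, fun p hp q hq => ?_⟩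
    rw [hdist, Real.sqrt_lt' hε]
    linarith [hur p q, hN p hp, hN q hq]
  obtain ⟨L, hL⟩ := cauchySeq_tendsto_of_complete hcau
  have hL2 : MemLp L 2 μ := Lp.memLp L
  have hlim : Tendsto (fun p => √(∫ ω, (u p ω - L ω) ^ 2 ∂μ)) atTop (𝓝 0) := by
    have h1 := tendsto_iff_dist_tendsto_zero.1 hL
    refine h1.congr fun p => ?_
    rw [← hdist (hu p) hL2, Lp.toLp_coeFn]
  -- Conditioning yields a `G`-measurable limit; it contracts `L²` and fixes each `u p`, so
  -- convergence survives.
  refine ⟨μ[L|G], stronglyMeasurable_condExp.measurable, hL2.condExp one_le_two, ?_⟩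
  have hbound : ∀ p, ∫ ω, (u p ω - (μ[L|G]) ω) ^ 2 ∂μ ≤ (√(∫ ω, (u p ω - L ω) ^ 2 ∂μ)) ^ 2 := by
    intro p
    have h1 : u p - μ[L|G] =ᵐ[μ] μ[u p - L|G] := by
      refine EventuallyEq.trans ?_
        (condExp_sub ((hu p).integrable one_le_two) (hL2.integrable one_le_two) G).symm
      rw [condExp_of_stronglyMeasurable hGm (hum p).stronglyMeasurable
        ((hu p).integrable one_le_two)]
    have h2 := eLpNorm_condExp_le_eLpNorm (μ := μ) (m := G) (u p - ⇑L) one_le_two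
    rw [← eLpNorm_congr_ae h1, eLpNorm_two_eq ((hu p).sub (hL2.condExp one_le_two)),
      eLpNorm_two_eq ((hu p).sub hL2), ENNReal.ofReal_le_ofReal_iff (Real.sqrt_nonneg _),
      Real.sqrt_le_sqrt_iff (integral_nonneg fun ω => sq_nonneg _)] at h2
    rw [Real.sq_sqrt (integral_nonneg fun ω => sq_nonneg _)]
    exact h2
  refine squeeze_zero (fun p => integral_nonneg fun ω => sq_nonneg _) hbound ?_
  simpa using hlim.pow 2

lemma IsMartingaleDifference.of_tendsto [IsProbabilityMeasure μ] {u : ℕ → Ω → ℝ}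
    (hu : ∀ p, IsMartingaleDifference μ T G (u p)) {D : Ω → ℝ} (hD : Measurable[G.comap T] D)
    (hD2 : MemLp D 2 μ) (h : Tendsto (fun p => ∫ ω, (u p ω - D ω) ^ 2 ∂μ) atTop (𝓝 0)) :
    IsMartingaleDifference μ T G D where
  measurable := hD
  memLp := hD2
  setIntegral_eq_zero A hA := by
    have h1 : Tendsto (fun p => eLpNorm (u p - D) 2 μ) atTop (𝓝 0) := by
      have h2 := ENNReal.tendsto_ofReal ((Real.continuous_sqrt.tendsto 0).comp h)
      rw [Real.sqrt_zero, ENNReal.ofReal_zero] at h2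
      exact h2.congr fun p => (eLpNorm_two_eq ((hu p).memLp.sub hD2)).symm
    have h3 : Tendsto (fun p => eLpNorm (u p - D) 1 μ) atTop (𝓝 0) :=
      tendsto_of_tendsto_of_tendsto_of_le_of_le tendsto_const_nhds h1 (fun _ => zero_le)
        fun p => eLpNorm_le_eLpNorm_of_exponent_le one_le_two ((hu p).memLp.sub hD2).1
    have h4 := tendsto_setIntegral_of_L1' D hD2.1
      (Eventually.of_forall fun p => (hu p).memLp.integrable one_le_two) h3 A
    simp only [(hu _).setIntegral_eq_zero A hA] at h4
    exact tendsto_nhds_unique h4 tendsto_const_nhds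

theorem exists_isMartingaleDifference_tendsto_maxSq [IsProbabilityMeasure μ]
    (hT : MeasurePreserving T μ μ) (hGm : G ≤ m)
    (hG : G ≤ G.comap T) (hf : Measurable[G] f) (hf2 : MemLp f 2 μ) {a : ℕ → ℝ}
    (ha : Summable a) (hcorr : CorrelationBound μ T G f a) :
    ∃ D : Ω → ℝ, IsMartingaleDifference μ T G D ∧
      Tendsto (fun n : ℕ => maxSq μ T (fun ω => f ω - D ω) n / (n : ℝ≥0∞)) atTop (𝓝 0) := by
  have hGT : G.comap T ≤ m := (MeasurableSpace.comap_mono hGm).trans hT.measurable.comap_le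
  have hr : Tendsto (fun p => meanTail a (p + 1)) atTop (𝓝 0) :=
    (tendsto_meanTail a).comp (tendsto_add_atTop_nat 1)
  have hu : ∀ p, IsMartingaleDifference μ T G (approxDifference μ T G f (p + 1)) := fun p =>
    isMartingaleDifference_approxDifference hT hGm hG hf hf2 p.succ_ne_zero
  obtain ⟨D, hD, hD2, hlim⟩ := exists_measurable_tendsto_integral_sq_sub hGT
    (u := fun p => approxDifference μ T G f (p + 1)) (fun p => (hu p).measurable)
    (fun p => (hu p).memLp) (r := fun p => 128 * meanTail a (p + 1))
    (by simpa using hr.const_mul 128) fun p q =>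
      (integral_sq_approxDifference_sub_le hT hGm hG hf hf2 ha hcorr p.succ_ne_zero
        q.succ_ne_zero).trans_eq (by ring)
  have hMD := IsMartingaleDifference.of_tendsto hu hD hD2 hlim
  refine ⟨D, hMD, ?_⟩
  have hev : ∀ ε : ℝ, 0 < ε → ∀ᶠ n : ℕ in atTop,
      maxSq μ T (fun ω => f ω - D ω) n ≤ ENNReal.ofReal (n * ε) := by
    intro ε hε
    -- The tolerances add up to `ε`: `2 (64 ε/512 + ε/4) + 2 · 8 · ε/64 = ε`.
    obtain ⟨p, hp1, hp2⟩ := ((hr.eventually_lt_const (show (0 : ℝ) < ε / 512 by positivity)).and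
      (hlim.eventually_lt_const (show (0 : ℝ) < ε / 64 by positivity))).exists
    have hrp := meanTail_nonneg hcorr.nonneg (p + 1)
    filter_upwards [eventually_maxSq_sub_approxDifference_le hT hGm hG hf2 ha hcorr p.succ_ne_zero
      (show (0 : ℝ) < ε / 4 by positivity)] with n hn
    have h1 := ((hu p).sub hMD).maxSq_le hT hGm hG n
    have h2 := maxSq_add_le (μ := μ) hT.measurable
      (u := fun ω => f ω - approxDifference μ T G f (p + 1) ω)
      (v := fun ω => approxDifference μ T G f (p + 1) ω - D ω)
      ((hf.mono hGm le_rfl).sub ((hu p).measurable.mono hGT le_rfl)) n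
    simp only [sub_add_sub_cancel] at h2
    have h3 := h2.trans (add_le_add (mul_le_mul_right hn 2) (mul_le_mul_right h1 2))
    have h4 : 0 ≤ ∫ ω, (approxDifference μ T G f (p + 1) ω - D ω) ^ 2 ∂μ :=
      integral_nonneg fun ω => sq_nonneg _
    rw [← ENNReal.ofReal_ofNat 2, ← ENNReal.ofReal_mul (by norm_num),
      ← ENNReal.ofReal_mul (by norm_num), ← ENNReal.ofReal_add (by positivity)
      (by positivity)] at h3
    refine h3.trans (ENNReal.ofReal_le_ofReal ?_)
    have hn0 : (0 : ℝ) ≤ n := n.cast_nonneg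
    nlinarith
  refine ENNReal.tendsto_nhds_zero.2 fun ε hε => ?_
  obtain ⟨ε', hε', hle⟩ : ∃ ε' : ℝ, 0 < ε' ∧ ENNReal.ofReal ε' ≤ ε := by
    obtain ⟨q, hq, hqε⟩ := ENNReal.lt_iff_exists_nnreal_btwn.1 hε
    exact ⟨q, by exact_mod_cast hq, by simpa using hqε.le⟩
  filter_upwards [hev ε' hε'] with n hn
  refine ENNReal.div_le_of_le_mul (hn.trans ?_)
  rw [ENNReal.ofReal_mul n.cast_nonneg, ENNReal.ofReal_natCast, mul_comm]
  gcongr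

end Limit

/-! ### Covariance inequalities under strong mixing -/

section Covariance

variable {Ω : Type*} {𝒜 ℬ m : MeasurableSpace Ω} {μ : Measure Ω}

lemma memLp_two_of_abs_le [IsProbabilityMeasure μ] {U : Ω → ℝ} (hU : Measurable U) {K : ℝ}
    (h : ∀ ω, |U ω| ≤ K) : MemLp U 2 μ :=
  MemLp.of_bound hU.aestronglyMeasurable K (ae_of_all _ h)

lemma abs_integral_le_integral {g h : Ω → ℝ} (hg : Integrable g μ) (hle : ∀ ω, |h ω| ≤ g ω) :
    |∫ ω, h ω ∂μ| ≤ ∫ ω, g ω ∂μ := by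
  rw [← Real.norm_eq_abs]
  exact norm_integral_le_of_norm_le hg (ae_of_all _ hle)

/-- Testing on the set where `E[V | 𝒜] ≥ 0` and on its complement gives `E |E[V | 𝒜]| ≤ 2c`. -/
lemma abs_integral_mul_le_of_setIntegral [IsProbabilityMeasure μ] (h𝒜 : 𝒜 ≤ m) {U V : Ω → ℝ}
    {K c : ℝ} (hU : Measurable[𝒜] U) (hUK : ∀ ω, |U ω| ≤ K) (hV : MemLp V 2 μ)
    (hc : ∀ A, MeasurableSet[𝒜] A → |∫ ω in A, V ω ∂μ| ≤ c) :
    |∫ ω, U ω * V ω ∂μ| ≤ 2 * K * c := by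
  have hU2 : MemLp U 2 μ := memLp_two_of_abs_le (hU.mono h𝒜 le_rfl) hUK
  set g := μ[V|𝒜] with hg
  have hgm : Measurable[𝒜] g := stronglyMeasurable_condExp.measurable
  have hgi : Integrable g μ := integrable_condExp
  have hK : 0 ≤ K := by
    obtain ⟨ω⟩ := μ.nonempty_of_neZero
    exact (abs_nonneg _).trans (hUK ω)
  have hP : MeasurableSet[𝒜] {ω | 0 ≤ g ω} := measurableSet_le measurable_const hgm
  have h1 := hc _ hP
  have h2 := hc _ hP.compl
  rw [← setIntegral_condExp h𝒜 (hV.integrable one_le_two) hP] at h1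
  rw [← setIntegral_condExp h𝒜 (hV.integrable one_le_two) hP.compl] at h2
  have h3 : ∫ ω, |g ω| ∂μ ≤ 2 * c := by
    rw [← integral_add_compl (h𝒜 _ hP) hgi.abs,
      setIntegral_congr_fun (h𝒜 _ hP) (g := g) fun ω hω => abs_of_nonneg hω,
      setIntegral_congr_fun (h𝒜 _ hP.compl) (g := fun ω => -g ω) fun ω hω =>
        abs_of_neg (not_le.1 hω), integral_neg]
    linarith [(abs_le.1 h1).2, (abs_le.1 h2).1]
  rw [← integral_mul_eq_integral_mul_condExp h𝒜 hU hU2 hV]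
  calc |∫ ω, U ω * g ω ∂μ| ≤ ∫ ω, K * |g ω| ∂μ := by
        refine abs_integral_le_integral (hgi.abs.const_mul K) fun ω => ?_
        rw [abs_mul]
        exact mul_le_mul_of_nonneg_right (hUK ω) (abs_nonneg _)
    _ = K * ∫ ω, |g ω| ∂μ := integral_const_mul _ _
    _ ≤ K * (2 * c) := by gcongr
    _ = _ := by ring

/-- The covariance inequality for bounded variables. -/
lemma abs_integral_mul_sub_integral_le [IsProbabilityMeasure μ] (h𝒜 : 𝒜 ≤ m) (hℬ : ℬ ≤ m)
    {U v : Ω → ℝ} {K α : ℝ} (hU : Measurable[𝒜] U) (hUK : ∀ ω, |U ω| ≤ K)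
    (hv : Measurable[ℬ] v) (hvK : ∀ ω, |v ω| ≤ K)
    (hα : ∀ A B, MeasurableSet[𝒜] A → MeasurableSet[ℬ] B →
      |μ.real (A ∩ B) - μ.real A * μ.real B| ≤ α) :
    |∫ ω, U ω * (v ω - ∫ ω', v ω' ∂μ) ∂μ| ≤ 4 * K ^ 2 * α := by
  have hv2 : MemLp v 2 μ := memLp_two_of_abs_le (hv.mono hℬ le_rfl) hvK
  have hvi : Integrable v μ := hv2.integrable one_le_two
  refine (abs_integral_mul_le_of_setIntegral h𝒜 hU hUK (hv2.sub (memLp_const _))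
    (c := 2 * K * α) fun A hA => ?_).trans_eq (by ring)
  -- The same bound is used again with the roles exchanged, `v` against the centred indicator of
  -- `A`; the two factors `2K` give `4 K²`.
  have hA' := h𝒜 A hA
  set V : Ω → ℝ := fun ω => A.indicator (fun _ => (1 : ℝ)) ω - μ.real A with hV
  have hV2 : MemLp V 2 μ := ((memLp_const (1 : ℝ)).indicator hA').sub (memLp_const _)
  have h1 := abs_integral_mul_le_of_setIntegral hℬ hv hvK hV2 (c := α) fun B hB => by
    have e : ∫ ω in B, V ω ∂μ = μ.real (A ∩ B) - μ.real A * μ.real B := by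
      simp only [hV]
      have hi : Integrable (A.indicator fun _ => (1 : ℝ)) μ := (integrable_const 1).indicator hA'
      rw [integral_sub hi.integrableOn (integrable_const _), integral_indicator_const 1 hA']
      simp [measureReal_restrict_apply hA', mul_comm]
    rw [e]
    exact hα A B hA hB
  have e : ∫ ω, v ω * V ω ∂μ = ∫ ω in A, (v ω - ∫ ω', v ω' ∂μ) ∂μ := by
    have e1 : ∀ ω, v ω * V ω = A.indicator v ω - μ.real A * v ω := by
      intro ω
      by_cases hω : ω ∈ A <;> simp [hV, hω] <;> ring
    simp only [e1]
    rw [integral_sub (hvi.indicator hA') (hvi.const_mul _), integral_indicator hA',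
      integral_const_mul, integral_sub hvi.integrableOn (integrable_const _)]
    simp
  change |∫ ω in A, (v ω - ∫ ω', v ω' ∂μ) ∂μ| ≤ _
  rw [← e]
  exact h1

/-- Truncation to the interval `[-t, t]`. -/
def clamp (t x : ℝ) : ℝ := max (-t) (min x t)

lemma abs_clamp_le {t : ℝ} (ht : 0 ≤ t) (x : ℝ) : |clamp t x| ≤ t :=
  abs_le.2 ⟨le_max_left _ _, max_le (by linarith) (min_le_right _ _)⟩

lemma measurable_clamp (t : ℝ) : Measurable (clamp t) :=
  measurable_const.max (measurable_id.min measurable_const)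

lemma sub_clamp_bounds {t : ℝ} (ht : 0 ≤ t) (x : ℝ) :
    2 * t * |x - clamp t x| ≤ excess t x ∧ (x - clamp t x) ^ 2 ≤ excess t x := by
  have h1 := sq_sub_sq_le_excess t x
  have h2 := excess_nonneg t x
  unfold clamp
  rcases le_total x t with h | h
  · rw [min_eq_left h]
    rcases le_total (-t) x with h' | h'
    · rw [max_eq_right h']; simpa using h2
    · rw [max_eq_left h', abs_of_nonpos (by linarith)]
      constructor <;> nlinarith
  · rw [min_eq_right h, max_eq_right (by linarith), abs_of_nonneg (by linarith)]
    constructor <;> nlinarith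

/-- Clamp both variables at `t`. The clamped parts give `4 t² α`. Recentring costs at most `e / 2`
because `Y` has mean zero, and the remainders at most `2e`. -/
lemma abs_integral_mul_le_excess [IsProbabilityMeasure μ] (h𝒜 : 𝒜 ≤ m) (hℬ : ℬ ≤ m)
    {W Y : Ω → ℝ} {t α e : ℝ} (ht : 0 ≤ t) (hW : Measurable[𝒜] W) (hW2 : MemLp W 2 μ)
    (hY : Measurable[ℬ] Y) (hY2 : MemLp Y 2 μ) (hY0 : ∫ ω, Y ω ∂μ = 0)
    (hWe : ∫ ω, excess t (W ω) ∂μ ≤ e) (hYe : ∫ ω, excess t (Y ω) ∂μ ≤ e)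
    (hα : ∀ A B, MeasurableSet[𝒜] A → MeasurableSet[ℬ] B →
      |μ.real (A ∩ B) - μ.real A * μ.real B| ≤ α) :
    |∫ ω, W ω * Y ω ∂μ| ≤ 4 * t ^ 2 * α + 3 * e := by
  set U : Ω → ℝ := fun ω => clamp t (W ω) with hU
  set v : Ω → ℝ := fun ω => clamp t (Y ω) with hv
  have hUm : Measurable[𝒜] U := (measurable_clamp t).comp hW
  have hvm : Measurable[ℬ] v := (measurable_clamp t).comp hY
  have hUt : ∀ ω, |U ω| ≤ t := fun ω => abs_clamp_le ht _
  have hvt : ∀ ω, |v ω| ≤ t := fun ω => abs_clamp_le ht _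
  have hU2 : MemLp U 2 μ := memLp_two_of_abs_le (hUm.mono h𝒜 le_rfl) hUt
  have hv2 : MemLp v 2 μ := memLp_two_of_abs_le (hvm.mono hℬ le_rfl) hvt
  have hcov := abs_integral_mul_sub_integral_le h𝒜 hℬ hUm hUt hvm hvt hα
  set c := ∫ ω, v ω ∂μ with hc
  have iW := integrable_excess hW2 t
  have iY := integrable_excess hY2 t
  have iWY : Integrable (fun ω => excess t (W ω) + excess t (Y ω)) μ := iW.add iY
  have hce : t * |c| ≤ e / 2 := by
    have h1 : c = ∫ ω, (v ω - Y ω) ∂μ := by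
      rw [integral_sub (hv2.integrable one_le_two) (hY2.integrable one_le_two), hY0, sub_zero]
    have h2 : |t * c| ≤ ∫ ω, excess t (Y ω) / 2 ∂μ := by
      rw [h1, ← integral_const_mul]
      refine abs_integral_le_integral (iY.div_const 2) fun ω => ?_
      rw [abs_mul, abs_of_nonneg ht, abs_sub_comm]
      linarith [(sub_clamp_bounds ht (Y ω)).1]
    rw [abs_mul, abs_of_nonneg ht, integral_div] at h2
    linarith
  have i1 : Integrable (fun ω => W ω * Y ω) μ := hW2.integrable_mul hY2
  have i2 : Integrable (fun ω => U ω * (v ω - c)) μ :=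
    hU2.integrable_mul (hv2.sub (memLp_const c))
  have hrem : |∫ ω, (W ω * Y ω - U ω * (v ω - c)) ∂μ| ≤
      ∫ ω, (t * |c| + (excess t (W ω) + excess t (Y ω))) ∂μ := by
    refine abs_integral_le_integral ((integrable_const _).add iWY) fun ω => ?_
    obtain ⟨a1, a2⟩ := sub_clamp_bounds ht (W ω)
    obtain ⟨b1, b2⟩ := sub_clamp_bounds ht (Y ω)
    change 2 * t * |W ω - U ω| ≤ _ at a1
    change (W ω - U ω) ^ 2 ≤ _ at a2
    change 2 * t * |Y ω - v ω| ≤ _ at b1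
    change (Y ω - v ω) ^ 2 ≤ _ at b2
    have e1 : W ω * Y ω - U ω * (v ω - c) = U ω * c + (U ω * (Y ω - v ω) +
        ((W ω - U ω) * v ω + (W ω - U ω) * (Y ω - v ω))) := by ring
    have p1 : |U ω * c| ≤ t * |c| := by
      rw [abs_mul]; exact mul_le_mul_of_nonneg_right (hUt ω) (abs_nonneg _)
    have p2 : |U ω * (Y ω - v ω)| ≤ t * |Y ω - v ω| := by
      rw [abs_mul]; exact mul_le_mul_of_nonneg_right (hUt ω) (abs_nonneg _)
    have p3 : |(W ω - U ω) * v ω| ≤ t * |W ω - U ω| := by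
      rw [abs_mul, mul_comm]; exact mul_le_mul_of_nonneg_right (hvt ω) (abs_nonneg _)
    have p4 : |(W ω - U ω) * (Y ω - v ω)| ≤ ((W ω - U ω) ^ 2 + (Y ω - v ω) ^ 2) / 2 := by
      rw [abs_le]
      constructor <;> nlinarith [sq_nonneg (W ω - U ω + (Y ω - v ω)),
        sq_nonneg (W ω - U ω - (Y ω - v ω))]
    have q1 := abs_add_le (U ω * c) (U ω * (Y ω - v ω) +
        ((W ω - U ω) * v ω + (W ω - U ω) * (Y ω - v ω)))
    have q2 := abs_add_le (U ω * (Y ω - v ω))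
        ((W ω - U ω) * v ω + (W ω - U ω) * (Y ω - v ω))
    have q3 := abs_add_le ((W ω - U ω) * v ω) ((W ω - U ω) * (Y ω - v ω))
    rw [e1]
    linarith
  rw [integral_sub i1 i2, integral_add (integrable_const _) iWY,
    integral_add iW iY] at hrem
  simp only [integral_const, probReal_univ, smul_eq_mul, one_mul] at hrem
  have h3 := abs_sub_abs_le_abs_sub (∫ ω, W ω * Y ω ∂μ) (∫ ω, U ω * (v ω - c) ∂μ)
  have he : 0 ≤ e := (integral_nonneg fun ω => excess_nonneg t (Y ω)).trans hYe
  linarith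

lemma abs_sub_le_toReal_alphaCoeff [IsProbabilityMeasure μ] {A B : Set Ω}
    (hA : MeasurableSet[𝒜] A) (hB : MeasurableSet[ℬ] B) :
    |μ.real (A ∩ B) - μ.real A * μ.real B| ≤ (alphaCoeff μ 𝒜 ℬ).toReal := by
  have hle : ∀ A B : Set Ω, |μ.real (A ∩ B) - μ.real A * μ.real B| ≤ 1 := fun A B => by
    have h1 : μ.real (A ∩ B) ≤ 1 := measureReal_le_one
    have h2 : μ.real A * μ.real B ≤ 1 :=
      mul_le_one₀ measureReal_le_one measureReal_nonneg measureReal_le_one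
    have h3 : 0 ≤ μ.real A * μ.real B := by positivity
    have h4 : 0 ≤ μ.real (A ∩ B) := measureReal_nonneg
    exact abs_le.2 ⟨by linarith, by linarith⟩
  have hfin : alphaCoeff μ 𝒜 ℬ ≠ ∞ := by
    refine ne_top_of_le_ne_top ENNReal.one_ne_top (iSup₂_le fun A _ => iSup₂_le fun B _ => ?_)
    exact ENNReal.ofReal_le_one.2 (hle A B)
  rw [← ENNReal.ofReal_le_iff_le_toReal hfin]
  exact le_iSup₂_of_le (f := fun A (_ : MeasurableSet[𝒜] A) => ⨆ (B : Set Ω)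
    (_ : MeasurableSet[ℬ] B), ENNReal.ofReal |μ.real (A ∩ B) - μ.real A * μ.real B|) A hA
    (le_iSup₂_of_le (f := fun B (_ : MeasurableSet[ℬ] B) =>
      ENNReal.ofReal |μ.real (A ∩ B) - μ.real A * μ.real B|) B hB le_rfl)

/-- Below the quantile the tail probability exceeds `u`; let the level increase to the quantile. -/
lemma le_measure_absQuantile_le [IsProbabilityMeasure μ] {Z : Ω → ℝ} (hZ : Measurable Z)
    {u : ℝ≥0∞} (h0 : 0 < absQuantile μ Z u) : u ≤ μ {ω | absQuantile μ Z u ≤ ‖Z ω‖ₑ} := by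
  obtain ⟨s, hs, hsQ, hlim⟩ := exists_seq_strictMono_tendsto' h0
  have hset : {ω | absQuantile μ Z u ≤ ‖Z ω‖ₑ} = ⋂ n, {ω | s n < ‖Z ω‖ₑ} := by
    ext ω
    simp only [Set.mem_ofPred_eq, Set.mem_iInter]
    exact ⟨fun h n => (hsQ n).2.trans_le h, fun h => le_of_tendsto' hlim fun n => (h n).le⟩
  rw [hset]
  refine ge_of_tendsto' (tendsto_measure_iInter_atTop
    (fun n => (measurableSet_lt measurable_const hZ.enorm).nullMeasurableSet)
    (fun i j hij ω hω => (hs.monotone hij).trans_lt hω) ⟨0, measure_ne_top _ _⟩) fun n => ?_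
  by_contra! h
  exact (hsQ n).2.not_ge (sInf_le h.le)

lemma eq_zero_of_absQuantile_eq_top [IsProbabilityMeasure μ] {Z : Ω → ℝ} (hZ : Measurable Z)
    {u : ℝ≥0∞} (h : absQuantile μ Z u = ∞) : u = 0 := by
  have h1 := le_measure_absQuantile_le (μ := μ) hZ (u := u) (by simp [h])
  rw [h] at h1
  simpa using h1

end Covariance

/-! ### Correlations bounded by the quantile tail -/

section TailBound

variable {Ω : Type*} [MeasurableSpace Ω] {μ : Measure Ω} {X : ℤ → Ω → ℝ}

lemma IsStationary.identDistrib_zero (hstat : IsStationary X μ) (k : ℤ) :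
    IdentDistrib (X k) (X 0) μ μ := by
  have h := (hstat k).comp (measurable_pi_apply (0 : ℤ))
  simpa [Function.comp_def] using h

lemma setIntegral_sq_eq_toReal {Z : Ω → ℝ} (hZ2 : MemLp Z 2 μ) (S : Set Ω) :
    ∫ ω in S, Z ω ^ 2 ∂μ = (∫⁻ ω in S, ‖Z ω‖ₑ ^ 2 ∂μ).toReal := by
  rw [lintegral_enorm_sq (hZ2.restrict S),
    ENNReal.toReal_ofReal (integral_nonneg fun ω => sq_nonneg _)]

lemma integral_excess_le_and_sq_mul_le [IsProbabilityMeasure μ] {Z : Ω → ℝ} (hZ : Measurable Z)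
    (hZ2 : MemLp Z 2 μ) {u : ℝ≥0∞} (hQ : absQuantile μ Z u ≠ ∞) :
    ∫ ω, excess (absQuantile μ Z u).toReal (Z ω) ∂μ ≤
        ∫ ω in {ω | absQuantile μ Z u ≤ ‖Z ω‖ₑ}, Z ω ^ 2 ∂μ ∧
      (absQuantile μ Z u).toReal ^ 2 * u.toReal ≤
        ∫ ω in {ω | absQuantile μ Z u ≤ ‖Z ω‖ₑ}, Z ω ^ 2 ∂μ := by
  set Q := absQuantile μ Z u with hQdef
  set S := {ω | Q ≤ ‖Z ω‖ₑ} with hS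
  have hSm : MeasurableSet S := measurableSet_le measurable_const hZ.enorm
  have hmem : ∀ ω, ω ∈ S ↔ Q.toReal ≤ |Z ω| := fun ω => by
    rw [hS, Set.mem_ofPred_eq, Real.enorm_eq_ofReal_abs,
      ← ENNReal.le_ofReal_iff_toReal_le hQ (abs_nonneg _)]
  have hQ0 : 0 ≤ Q.toReal := ENNReal.toReal_nonneg
  constructor
  · rw [← integral_indicator hSm]
    refine integral_mono (integrable_excess hZ2 _) (hZ2.integrable_sq.indicator hSm) fun ω => ?_
    by_cases h : ω ∈ S
    · simpa [h] using excess_le_sq _ _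
    · have h' := not_le.1 (mt (hmem ω).2 h)
      simp only [h, not_false_eq_true, Set.indicator_of_notMem]
      exact (max_eq_right (sub_nonpos.2 (sq_le_sq.2 (by rw [abs_of_nonneg hQ0]; exact h'.le)))).le
  · have h1 : Q.toReal ^ 2 * μ.real S ≤ ∫ ω in S, Z ω ^ 2 ∂μ := by
      have h2 := setIntegral_mono_on (μ := μ) (f := fun _ => Q.toReal ^ 2) (g := fun ω => Z ω ^ 2)
        (integrable_const _).integrableOn hZ2.integrable_sq.integrableOn hSm fun ω hω =>
          sq_le_sq.2 (by rw [abs_of_nonneg hQ0]; exact (hmem ω).1 hω)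
      simpa [mul_comm] using h2
    rcases eq_or_ne Q 0 with h0 | h0
    · simp only [h0, ENNReal.toReal_zero, ne_eq, OfNat.ofNat_ne_zero, not_false_eq_true, zero_pow,
        zero_mul]
      exact integral_nonneg fun ω => sq_nonneg _
    · refine le_trans ?_ h1
      gcongr
      exact ENNReal.toReal_mono (measure_ne_top _ _)
        (le_measure_absQuantile_le hZ (pos_iff_ne_zero.2 h0))

/-- At `t = Q(2α)`, the term `4 t² α = 2 t² (2α)` costs two tail integrals and `3e` costs three,
hence the factor 5. -/
lemma abs_integral_mul_le_tail [IsProbabilityMeasure μ] (hX : ∀ i, Measurable (X i))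
    (hstat : IsStationary X μ) (hL2 : MemLp (X 0) 2 μ) (hmean : ∫ ω, X 0 ω ∂μ = 0)
    {W : Ω → ℝ} (hW : Measurable[past X hX 0] W) (hW2 : MemLp W 2 μ)
    (hdom : ∀ t, 0 ≤ t → ∫ ω, excess t (W ω) ∂μ ≤ ∫ ω, excess t (X 0 ω) ∂μ) (k : ℕ) :
    |∫ ω, W ω * X k ω ∂μ| ≤
      5 * (∫⁻ ω in {ω | absQuantile μ (X 0) (2 * alpha μ X hX k) ≤ ‖X 0 ω‖ₑ},
        ‖X 0 ω‖ₑ ^ 2 ∂μ).toReal := by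
  have hid := hstat.identDistrib_zero k
  have hXk2 : MemLp (X k) 2 μ := hid.memLp_iff.2 hL2
  have hXk0 : ∫ ω, X k ω ∂μ = 0 := hid.integral_eq.trans hmean
  have hXe : ∀ t, ∫ ω, excess t (X k ω) ∂μ = ∫ ω, excess t (X 0 ω) ∂μ := fun t =>
    (hid.comp (continuous_excess t).measurable).integral_eq
  have key : ∀ t, 0 ≤ t → |∫ ω, W ω * X k ω ∂μ| ≤
      4 * t ^ 2 * (alpha μ X hX k).toReal + 3 * ∫ ω, excess t (X 0 ω) ∂μ := fun t ht =>
    abs_integral_mul_le_excess ((past X hX).le 0) (hX k).comap_le ht hW hW2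
      (comap_measurable _) hXk2 hXk0 (hdom t ht) (hXe t).le
      fun A B hA hB => abs_sub_le_toReal_alphaCoeff hA hB
  -- An infinite quantile forces `α = 0`; letting the truncation level tend to infinity then gives
  -- zero correlation.
  by_cases hQ : absQuantile μ (X 0) (2 * alpha μ X hX k) = ∞
  · have h0 := eq_zero_of_absQuantile_eq_top (hX 0) hQ
    have hα : alpha μ X hX k = 0 := by simpa using h0
    have hlim := (tendsto_integral_excess hL2).const_mul 3
    have h1 : |∫ ω, W ω * X k ω ∂μ| ≤ 3 * 0 := ge_of_tendsto' hlim fun K => by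
      simpa [hα] using key K K.cast_nonneg
    exact h1.trans (by rw [mul_zero]; positivity)
  · obtain ⟨h1, h2⟩ := integral_excess_le_and_sq_mul_le (hX 0) hL2 hQ
    rw [ENNReal.toReal_mul, ENNReal.toReal_ofNat] at h2
    have h3 := key _ (ENNReal.toReal_nonneg (a := absQuantile μ (X 0) (2 * alpha μ X hX k)))
    rw [← setIntegral_sq_eq_toReal hL2]
    linarith

end TailBound

/-! ### The path space and its shift -/

section PathSpace

/-- The shift of time by `k` on the space of two-sided paths. -/
def shift (k : ℤ) (x : ℤ → ℝ) (i : ℤ) : ℝ := x (i + k)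

lemma measurable_shift (k : ℤ) : Measurable (shift k) :=
  measurable_pi_lambda _ fun i => measurable_pi_apply (i + k)

lemma shift_one_iterate (n : ℕ) : (shift 1)^[n] = shift n := by
  induction n with
  | zero => funext x i; simp [shift]
  | succ n ih =>
    funext x i
    rw [Function.iterate_succ_apply', ih]
    simp only [shift]
    congr 1
    push_cast
    ring

/-- The `σ`-field of the coordinates with nonpositive index. -/
abbrev coordPast : MeasurableSpace (ℤ → ℝ) :=
  ⨆ j ≤ (0 : ℤ), MeasurableSpace.comap (fun x => x j) inferInstance

lemma coordPast_le : coordPast ≤ MeasurableSpace.pi :=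
  iSup₂_le fun j _ => (measurable_pi_apply j).comap_le

variable {Ω : Type*} [MeasurableSpace Ω] {μ : Measure Ω} {X : ℤ → Ω → ℝ}

lemma past_eq_comap (hX : ∀ i, Measurable (X i)) (k : ℤ) :
    past X hX k = coordPast.comap (fun ω i => X (i + k) ω) := by
  change ⨆ j ≤ k, MeasurableSpace.comap (X j) _ = _
  simp only [coordPast, MeasurableSpace.comap_iSup, MeasurableSpace.comap_comp]
  refine le_antisymm (iSup₂_le fun j hj => ?_) (iSup₂_le fun j hj => ?_)
  · refine le_iSup₂_of_le (j - k) (by omega) (le_of_eq ?_)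
    congr 1
    funext ω
    simp
  · exact le_iSup₂_of_le (j + k) (by omega) le_rfl

lemma coordPast_le_comap_shift : coordPast ≤ coordPast.comap (shift 1) := by
  conv_rhs => simp only [coordPast, MeasurableSpace.comap_iSup, MeasurableSpace.comap_comp]
  refine iSup₂_le fun j hj => le_iSup₂_of_le (j - 1) (by omega) (le_of_eq ?_)
  congr 1
  funext x
  simp [shift]

lemma IsStationary.measurePreserving (hstat : IsStationary X μ) (hX : ∀ i, Measurable (X i))
    (k : ℤ) : MeasurePreserving (fun ω i => X (i + k) ω) μ (μ.map fun ω i => X i ω) :=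
  ⟨measurable_pi_lambda _ fun i => hX (i + k), (hstat k).map_eq⟩

lemma IsStationary.measurePreserving_shift (hstat : IsStationary X μ)
    (hX : ∀ i, Measurable (X i)) (k : ℤ) :
    MeasurePreserving (shift k) (μ.map fun ω i => X i ω) (μ.map fun ω i => X i ω) := by
  refine ⟨measurable_shift k, ?_⟩
  rw [Measure.map_map (measurable_shift k) (measurable_pi_lambda _ hX)]
  exact (hstat k).map_eq

end PathSpace

/-! ### Transfer between the process and path space -/

section Transfer

variable {Ω : Type*} [MeasurableSpace Ω] {μ : Measure Ω} {X : ℤ → Ω → ℝ}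

lemma correlationBound_pathSpace [IsProbabilityMeasure μ] (hX : ∀ i, Measurable (X i))
    (hstat : IsStationary X μ) (hL2 : MemLp (X 0) 2 μ) (hmean : ∫ ω, X 0 ω ∂μ = 0) :
    CorrelationBound (μ.map fun ω i => X i ω) (shift 1) coordPast (fun x => x 0) fun q =>
      5 * (∫⁻ ω in {ω | absQuantile μ (X 0) (2 * alpha μ X hX (q + 1)) ≤ ‖X 0 ω‖ₑ},
        ‖X 0 ω‖ₑ ^ 2 ∂μ).toReal := by
  intro W hW hW2 hdom q
  have hπ : MeasurePreserving (fun ω i => X i ω) μ (μ.map fun ω i => X i ω) :=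
    ⟨measurable_pi_lambda _ hX, rfl⟩
  have hWm : Measurable W := hW.mono coordPast_le le_rfl
  have hWX : Measurable[past X hX 0] fun ω => W (fun i => X i ω) := by
    have e : past X hX 0 = coordPast.comap fun ω i => X i ω := by simp [past_eq_comap hX 0]
    rw [e]
    exact @Measurable.comp _ _ _ (coordPast.comap fun ω i => X i ω) coordPast _ _ _ hW
      (comap_measurable _)
  have h1 := abs_integral_mul_le_tail hX hstat hL2 hmean hWX (hW2.comp_measurePreserving hπ)
    (fun t ht => by
      rw [integral_comp_of_measurePreserving hπ (h := fun x => excess t (W x))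
          ((continuous_excess t).measurable.comp hWm).aestronglyMeasurable]
      refine (hdom t ht).trans_eq ?_
      exact (integral_comp_of_measurePreserving hπ (h := fun x => excess t (x 0))
        ((continuous_excess t).measurable.comp (measurable_pi_apply 0)).aestronglyMeasurable).symm)
    (q + 1)
  rw [← integral_comp_of_measurePreserving hπ (h := fun x => W x * ((shift 1)^[q + 1] x) 0)
    (hWm.mul ((measurable_pi_apply 0).comp
      ((measurable_shift 1).iterate (q + 1)))).aestronglyMeasurable]
  simpa [shift_one_iterate, shift] using h1

/-- A martingale difference on the path space yields stationary martingale differences adapted to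
the past of `X`. -/
lemma IsMartingaleDifference.martingale_partialSum [IsProbabilityMeasure μ]
    (hX : ∀ i, Measurable (X i)) (hstat : IsStationary X μ) {D : (ℤ → ℝ) → ℝ}
    (hD : IsMartingaleDifference (μ.map fun ω i => X i ω) (shift 1) coordPast D) :
    (∀ i : ℤ, Measurable[past X hX (i + 1)] fun ω => D fun j => X (j + i) ω) ∧
    (∀ i : ℤ, MemLp (fun ω => D fun j => X (j + i) ω) 2 μ) ∧
    IsStationary (fun i ω => (X i ω, D fun j => X (j + i) ω)) μ ∧
    Martingale (partialSum fun i ω => D fun j => X (j + i) ω) (pastNat X hX) μ := by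
  have hGT : coordPast.comap (shift 1) ≤ MeasurableSpace.pi :=
    (MeasurableSpace.comap_mono coordPast_le).trans (measurable_shift 1).comap_le
  have hDm : Measurable D := hD.measurable.mono hGT le_rfl
  have hmeas : ∀ i : ℤ, Measurable[past X hX (i + 1)] fun ω => D fun j => X (j + i) ω := by
    intro i
    -- Recentring the path at `i` turns the coordinates of index at most 1, which determine `D`,
    -- into the past at time `i + 1`.
    have e : past X hX (i + 1) =
        (coordPast.comap (shift 1)).comap fun ω j => X (j + i) ω := by
      rw [past_eq_comap, MeasurableSpace.comap_comp]
      congr 1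
      funext ω j
      simp only [Function.comp_apply, shift]
      rw [add_assoc, add_comm 1 i]
    rw [e]
    exact @Measurable.comp _ _ _ ((coordPast.comap (shift 1)).comap fun ω j => X (j + i) ω)
      (coordPast.comap (shift 1)) _ _ _ hD.measurable (comap_measurable _)
  have hmem : ∀ i : ℤ, MemLp (fun ω => D fun j => X (j + i) ω) 2 μ := fun i =>
    hD.memLp.comp_measurePreserving (hstat.measurePreserving hX i)
  refine ⟨hmeas, hmem, fun k => ?_, ?_⟩
  · have hΦ : Measurable fun (x : ℤ → ℝ) (i : ℤ) => (x i, D (shift i x)) :=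
      measurable_pi_lambda _ fun i =>
        (measurable_pi_apply i).prodMk (hDm.comp (measurable_shift i))
    convert (hstat k).comp hΦ using 1
    · funext ω i
      refine Prod.ext rfl (congrArg D (funext fun j => ?_))
      simp [shift, add_assoc]
    · rfl
  · refine martingale_of_setIntegral_eq_succ (fun n => ?_)
      (fun n => integrable_finsetSum _ fun i _ => (hmem i).integrable one_le_two)
      fun n A hA => ?_
    · refine Measurable.stronglyMeasurable ?_
      refine Finset.measurable_fun_sum _ fun i hi => (hmeas i).mono ((past X hX).mono ?_) le_rfl
      have := Finset.mem_range.1 hi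
      omega
    · have hA' : MeasurableSet[past X hX (n : ℤ)] A := hA
      rw [past_eq_comap] at hA'
      obtain ⟨B, hB, rfl⟩ := hA'
      have h0 := setIntegral_comp_of_measurePreserving (hstat.measurePreserving hX n)
        (coordPast_le B hB) hD.memLp.1
      rw [hD.setIntegral_eq_zero B hB] at h0
      simp only [partialSum, Finset.sum_range_succ _ n]
      have hi : ∀ i : ℤ, Integrable (fun ω => D fun j => X (j + i) ω)
          (μ.restrict ((fun ω i => X (i + n) ω) ⁻¹' B)) := fun i =>
        ((hmem i).integrable one_le_two).integrableOn
      rw [integral_add (f := fun ω => ∑ i ∈ Finset.range n, D fun j => X (j + i) ω)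
        (g := fun ω => D fun j => X (j + n) ω) (integrable_finsetSum _ fun i _ => hi i) (hi n),
        h0, add_zero]

lemma lintegral_iSup_partialSum_sub (hX : ∀ i, Measurable (X i)) {D : (ℤ → ℝ) → ℝ}
    (hD : Measurable D) (n : ℕ) :
    ∫⁻ ω, ⨆ j ∈ Finset.Icc 1 n,
        ‖partialSum X j ω - partialSum (fun i ω => D fun j => X (j + i) ω) j ω‖ₑ ^ 2 ∂μ =
      maxSq (μ.map fun ω i => X i ω) (shift 1) (fun x => x 0 - D x) n := by
  have hm : Measurable fun x : ℤ → ℝ => ⨆ j ∈ Finset.Icc 1 n,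
      ‖∑ i ∈ Finset.range j, (((shift 1)^[i] x) 0 - D ((shift 1)^[i] x))‖ₑ ^ 2 :=
    Measurable.iSup fun j => Measurable.iSup_Prop _ <| Measurable.pow_const (Measurable.enorm <|
      Finset.measurable_fun_sum _ fun i _ =>
        ((measurable_pi_apply 0).sub hD).comp ((measurable_shift 1).iterate i)) 2
  rw [maxSq, lintegral_map hm (measurable_pi_lambda _ hX)]
  simp only [partialSum, shift_one_iterate, ← Finset.sum_sub_distrib, shift, zero_add]
  rfl

end Transfer

end StrongMixing

/-! ### The main theorem -/

theorem mainTheorem8 {Ω : Type*} [MeasurableSpace Ω] (μ : Measure Ω) [IsProbabilityMeasure μ]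
    (X : ℤ → Ω → ℝ) (hX : ∀ i, Measurable (X i))
    (hstat : StrongMixing.IsStationary X μ)
    (hL2 : MemLp (X 0) 2 μ) (hmean : ∫ ω, X 0 ω ∂μ = 0)
    (hmix : StrongMixing.DoukhanMassartRioCondition μ X hX) :
    StrongMixing.HasMaximalMartingaleApproximation μ X hX := by
  open StrongMixing in
  have hπ : MeasurePreserving (fun ω i => X i ω) μ (μ.map fun ω i => X i ω) :=
    ⟨measurable_pi_lambda _ hX, rfl⟩
  have := Measure.isProbabilityMeasure_map (μ := μ) hπ.measurable.aemeasurable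
  have hf : Measurable[coordPast] fun x : ℤ → ℝ => x 0 :=
    (comap_measurable fun x : ℤ → ℝ => x 0).mono
      (le_iSup₂_of_le (f := fun (j : ℤ) (_ : j ≤ 0) =>
        MeasurableSpace.comap (fun x : ℤ → ℝ => x j) inferInstance) 0 le_rfl le_rfl) le_rfl
  have hf2 : MemLp (fun x : ℤ → ℝ => x 0) 2 (μ.map fun ω i => X i ω) :=
    (memLp_map_measure_iff (measurable_pi_apply 0).aestronglyMeasurable
      hπ.measurable.aemeasurable).2 hL2
  obtain ⟨D, hD, hlim⟩ := exists_isMartingaleDifference_tendsto_maxSq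
    (hstat.measurePreserving_shift hX 1) coordPast_le coordPast_le_comap_shift hf hf2
    ((ENNReal.summable_toReal hmix.ne).mul_left 5)
    (correlationBound_pathSpace hX hstat hL2 hmean)
  obtain ⟨h1, h2, h3, h4⟩ := hD.martingale_partialSum hX hstat
  refine ⟨fun i ω => D fun j => X (j + i) ω, fun i => (h1 i).stronglyMeasurable, h2, h3, h4, ?_⟩
  have hDm : Measurable D := hD.measurable.mono
    ((MeasurableSpace.comap_mono coordPast_le).trans (measurable_shift 1).comap_le) le_rfl
  simp only [lintegral_iSup_partialSum_sub hX hDm]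
  exact hlim
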